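/- **Clifford conventions.** Let $\mathbb{C}\mathrm{l}_k$ be the complexified Clifford algebra of Euclidean $\mathbb{R}^k$ with standard basis $E_1,\dots,E_k$ and $v\cdot v=-|v|^2$. Put $\omega_k=\epsilon_kE_1\cdots E_k$, where $\epsilon_k=1,-i,i,1$ for $k\equiv 0,1,2,3 \pmod 4$, so that $\omega_k^2=1$. Let $\Sigma_k$ be an irreducible complex $\mathbb{C}\mathrm{l}_k$-module with a Hermitian product for which unit vectors act isometrically; for $k$ odd, $\Sigma_k$ is the one on which $\omega_k$ acts as $1$, and $\Sigma_k^{\#}$ is the one on which $\omega_k$ acts as $-1$. Regard $\mathbb{C}\mathrm{l}_{n-1}\subset\mathbb{C}\mathrm{l}_n$ via $x\mapsto(x,0)$. * If $n$ is odd, let $J:\Sigma_{n-1}\to\Sigma_n$ and $J^{\#}:\Sigma_{n-1}\to\Sigma_n^{\#}$ be isometric isomorphisms of $\mathbb{C}\mathrm{l}_{n-1}$-modules. * If $n$ is even, let $I:\Sigma_{n-1}\oplus\Sigma_{n-1}^{\#}\to\Sigma_n$ be an isometric isomorphism of $\mathbb{C}\mathrm{l}_{n-1}$-modules, and let $J^{\pm}:\Sigma_{n-1}\to\Sigma_n$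 and $J^{\#,\pm}:\Sigma^{\#}_{n-1}\to\Sigma_n$ be the maps $\phi\mapsto\frac1{\sqrt2}\left(I(\phi)\mp i\,E_n\cdot I(\phi)\right)$. **Geometric setting.** Let $M$ be a smooth oriented $(n-1)$-dimensional manifold, let $(g_s)_{s\in(a,b)}$ be a family of Riemannian metrics on $M$ such that $h=g_s+ds^2$ is a smooth Riemannian metric on $N=M\times(a,b)$, and put $\nu=\partial/\partial s$. Let $T_MN=\coprod_sT(M\times\{s\})$. Let $P_{\mathrm{Spin},M}(N)\to N$ be a $\mathrm{Spin}(n-1)$-principal bundle with an equivariant map to the bundle of positively oriented $g_s$-orthonormal frames of $T_MN$. Restricted to $M\times\{s\}$ it is a spin structure on $(M,g_s)$, and $P_{\mathrm{Spin}}(N)=P_{\mathrm{Spin},M}(N)\times_{\mathrm{Spin}(n-1)}\mathrm{Spin}(n)$, with $(e_1,\dots,e_{n-1})\mapsto(e_1,\dots,e_{n-1},\nu)$ on frames, is a spin structure on $(N,h)$. Let $\Sigma_M^{(\#)}N=P_{\mathrm{Spin},M}(N)\times_{\mathrm{Spin}(n-1)}\Sigma^{(\#)}_{n-1}=\coprod_s\Sigma^{(\#),g_s}M$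 and $\Sigma^{(\#)}N=P_{\mathrm{Spin}}(N)\times_{\mathrm{Spin}(n)}\Sigma^{(\#)}_n$, with Clifford multiplication $\star$ by $TN$ on $\Sigma^{(\#)}N$. The algebraic maps above induce bundle maps $[q,\sigma]\mapsto[q,J^{(\#),(\pm)}\sigma]$ between these bundles, denoted by the same symbols. Let $\nabla^{M,g_s}$ and $\nabla^N$ be the Levi-Civita connections of $(M,g_s)$ and $(N,h)$, and also the connections they induce on the spinor bundles: for a local section $q$ of the spin bundle over an orthonormal frame $(e_j)$, $$\nabla_X[q,\sigma]=\Big[q,\ \partial_X\sigma+\tfrac14\sum_{j,k}\langle\nabla_Xe_j,e_k\rangle\,E_j\cdot E_k\cdot\sigma\Big].$$ **Statement.** There is a unique field $W$ of endomorphisms of $T_MN$ (the Weingarten map) with $$g_s(W(X),Y)\,\nu=\nabla^N_XY-\nabla^{M,g_s}_XY$$ for all $X\in T_MN$ and all smooth local sections $Y$ of $T_MN$. If $J^{(\#),(\pm)}$ is any of the above bundle maps, then for every $X\in\Gamma(T_MN)$ and every smooth section $\phi$ of $\Sigma_MN$, resp. $\Sigma_M^{\#}N$, $$\nabla^N_XJ^{(\#),(\pm)}(\phi)=J^{(\#),(\pm)}\big(\nabla^{M,g_s}_X\phi\big)+\tfrac12\,W(X)\star\nu\star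 J^{(\#),(\pm)}(\phi).$$ -/

import Mathlib

open Bundle Manifold TopologicalSpace
open scoped ContDiff TensorProduct

universe u v

noncomputable section

/-! ## Clifford algebras, the spin group and Clifford modules -/

/-- Euclidean space `ℝᵏ`. -/
abbrev Euc (k : ℕ) : Type := EuclideanSpace ℝ (Fin k)

/-- The quadratic form `v ↦ -|v|²` on `ℝᵏ`, so that `v · v = -|v|²` in the Clifford algebra. -/
def cliffordForm (k : ℕ) : QuadraticForm ℝ (Euc k) :=
  -(LinearMap.BilinMap.toQuadraticMap (innerₗ (Euc k)))

theorem cliffordForm_apply (k : ℕ) (v : Euc k) : cliffordForm k v = -‖v‖ ^ 2 := by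
  simp [cliffordForm]

/-- The real Clifford algebra of `ℝᵏ`. -/
abbrev Cl (k : ℕ) : Type := CliffordAlgebra (cliffordForm k)

/-- The complexified Clifford algebra of `ℝᵏ`. -/
abbrev CCl (k : ℕ) : Type := ℂ ⊗[ℝ] Cl k

/-- The inclusion `ℝᵏ ⊂ Cl k`. -/
def clVec {k : ℕ} (v : Euc k) : Cl k := CliffordAlgebra.ι (cliffordForm k) v

/-- The standard basis vectors `E₁, …, E_k` of `ℝᵏ`. -/
def stdVec {k : ℕ} (i : Fin k) : Euc k := EuclideanSpace.single i 1

/-- The group `Spin(k)`, inside the Clifford algebra. -/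
abbrev Spin (k : ℕ) : Submonoid (Cl k) := spinGroup (cliffordForm k)

/-- The normalisation `ε_k` of the complex volume element. -/
def volumeSign (k : ℕ) : ℂ :=
  if k % 4 = 1 then -Complex.I else if k % 4 = 2 then Complex.I else 1

/-- The complex volume element `ω = ε_k E₁ · E₂ ⋯ E_k`. -/
def complexVolume (k : ℕ) : CCl k :=
  volumeSign k • ((1 : ℂ) ⊗ₜ[ℝ] (List.ofFn fun i : Fin k ↦ clVec (stdVec i)).prod)

/-- The inclusion `ℝᵐ → ℝᵐ⁺¹`, `x ↦ (x, 0)`. -/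
def eucIncl (m : ℕ) : Euc m →ₗ[ℝ] Euc (m + 1) where
  toFun v := WithLp.toLp 2 (Fin.snoc (α := fun _ ↦ ℝ) v.ofLp 0)
  map_add' v w := by
    ext i
    refine Fin.lastCases ?_ (fun j ↦ ?_) i <;> simp
  map_smul' c v := by
    ext i
    refine Fin.lastCases ?_ (fun j ↦ ?_) i <;> simp

theorem eucIncl_castSucc {m : ℕ} (v : Euc m) (i : Fin m) : eucIncl m v i.castSucc = v i := by
  simp [eucIncl]

theorem eucIncl_last {m : ℕ} (v : Euc m) : eucIncl m v (Fin.last m) = 0 := by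
  simp [eucIncl]

/-- `x ↦ (x, 0)` as an isometry of quadratic spaces. -/
def eucInclIsometry (m : ℕ) : cliffordForm m →qᵢ cliffordForm (m + 1) where
  toLinearMap := eucIncl m
  map_app' v := by
    have : ‖eucIncl m v‖ ^ 2 = ‖v‖ ^ 2 := by
      rw [EuclideanSpace.norm_sq_eq, EuclideanSpace.norm_sq_eq, Fin.sum_univ_castSucc]
      simp [eucIncl_castSucc, eucIncl_last]
    simp only [cliffordForm_apply]
    exact congrArg Neg.neg this

/-- The induced inclusion `Cl m → Cl (m+1)`. -/
def clIncl (m : ℕ) : Cl m →ₐ[ℝ] Cl (m + 1) := CliffordAlgebra.map (eucInclIsometry m)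

theorem clIncl_clVec {m : ℕ} (v : Euc m) : clIncl m (clVec v) = clVec (eucIncl m v) :=
  CliffordAlgebra.map_apply_ι _ _

/-- The induced inclusion of complexified Clifford algebras. -/
def cclIncl (m : ℕ) : CCl m →ₐ[ℂ] CCl (m + 1) :=
  Algebra.TensorProduct.map (AlgHom.id ℂ ℂ) (clIncl m)

theorem clIncl_star {m : ℕ} (x : Cl m) : clIncl m (star x) = star (clIncl m x) := by
  rw [CliffordAlgebra.star_def, CliffordAlgebra.star_def]
  induction x using CliffordAlgebra.induction with
  | algebraMap r => simp
  | ι v =>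
    have := clIncl_clVec v
    simp only [clVec] at this
    simp [this]
  | mul a b ha hb => simp [ha, hb]
  | add a b ha hb => simp [ha, hb]

theorem clIncl_mem_even {m : ℕ} {x : Cl m} (hx : x ∈ CliffordAlgebra.evenOdd (cliffordForm m) 0) :
    clIncl m x ∈ CliffordAlgebra.evenOdd (cliffordForm (m + 1)) 0 := by
  induction x, hx using CliffordAlgebra.even_induction with
  | algebraMap r =>
    rw [AlgHom.commutes]
    exact SetLike.algebraMap_mem_graded _ r
  | add x y hx hy h1 h2 =>
    rw [map_add]
    exact Submodule.add_mem _ h1 h2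
  | ι_mul_ι_mul v w x hx h =>
    have hv := clIncl_clVec v
    have hw := clIncl_clVec w
    simp only [clVec] at hv hw
    rw [map_mul, map_mul, hv, hw]
    have := SetLike.mul_mem_graded (CliffordAlgebra.ι_mul_ι_mem_evenOdd_zero
      (cliffordForm (m + 1)) (eucIncl m v) (eucIncl m w)) h
    simpa using this

theorem clIncl_mem_spin {m : ℕ} {x : Cl m} (hx : x ∈ Spin m) : clIncl m x ∈ Spin (m + 1) := by
  obtain ⟨⟨⟨u, hu, rfl⟩, hx2⟩, hx3⟩ := hx
  refine ⟨⟨⟨Units.map (clIncl m : Cl m →* Cl (m + 1)) u, ?_, rfl⟩, ?_⟩, ?_⟩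
  · have hle : lipschitzGroup (cliffordForm m) ≤
        (lipschitzGroup (cliffordForm (m + 1))).comap
          (Units.map (clIncl m : Cl m →* Cl (m + 1))) := by
      refine (Subgroup.closure_le _).2 ?_
      rintro y ⟨v, hv⟩
      refine Subgroup.subset_closure ⟨eucIncl m v, ?_⟩
      have := clIncl_clVec v
      simp only [clVec] at this
      simp [← this, hv]
    exact hle hu
  · constructor
    · have := hx2.1
      rw [← clIncl_star]
      exact (map_mul (clIncl m) _ _).symm.trans (by rw [this, map_one])
    · have := hx2.2
      rw [← clIncl_star]
      exact (map_mul (clIncl m) _ _).symm.trans (by rw [this, map_one])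
  · exact clIncl_mem_even hx3

/-- The homomorphism `Spin(m) → Spin(m+1)` covering `A ↦ diag(A, 1)`. -/
def spinIncl (m : ℕ) : Spin m →* Spin (m + 1) where
  toFun x := ⟨clIncl m x, clIncl_mem_spin x.2⟩
  map_one' := Subtype.ext (map_one _)
  map_mul' _ _ := Subtype.ext (map_mul _ _ _)

theorem exists_eucIncl_add {m : ℕ} (v : Euc (m + 1)) :
    ∃ (u : Euc m) (t : ℝ), v = eucIncl m u + t • stdVec (Fin.last m) := by
  refine ⟨WithLp.toLp 2 fun i ↦ v i.castSucc, v (Fin.last m), ?_⟩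
  ext i
  refine Fin.lastCases ?_ (fun j ↦ ?_) i
  · simp [eucIncl_last, stdVec]
  · simp [eucIncl_castSucc, stdVec, Fin.castSucc_ne_last]

theorem clVec_injective {k : ℕ} : Function.Injective (clVec (k := k)) := by
  have : Invertible (2 : ℝ) := invertibleOfNonzero two_ne_zero
  intro v w h
  have h0 : clVec (v - w) = 0 := by
    have h' : clVec v - clVec w = 0 := sub_eq_zero.2 h
    rw [← h']
    exact map_sub _ v w
  have h1 : algebraMap ℝ (Cl k) (cliffordForm k (v - w)) = 0 := by
    rw [← CliffordAlgebra.ι_sq_scalar]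
    change clVec (v - w) * clVec (v - w) = 0
    rw [h0, zero_mul]
  have h2 := (map_eq_zero_iff _ (FaithfulSMul.algebraMap_injective ℝ (Cl k))).1 h1
  rw [cliffordForm_apply] at h2
  have h3 : ‖v - w‖ = 0 := by
    rw [neg_eq_zero] at h2
    exact pow_eq_zero_iff (two_ne_zero) |>.1 h2
  exact sub_eq_zero.1 (norm_eq_zero.1 h3)

theorem commute_clIncl_last {m : ℕ} {x : Cl m}
    (hx : x ∈ CliffordAlgebra.evenOdd (cliffordForm m) 0) :
    clIncl m x * clVec (stdVec (Fin.last m)) = clVec (stdVec (Fin.last m)) * clIncl m x := by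
  have anti : ∀ v : Euc m, clVec (eucIncl m v) * clVec (stdVec (Fin.last m)) =
      -(clVec (stdVec (Fin.last m)) * clVec (eucIncl m v)) := fun v ↦ by
    refine CliffordAlgebra.ι_mul_ι_comm_of_isOrtho ?_
    rw [QuadraticMap.isOrtho_def, cliffordForm_apply, cliffordForm_apply, cliffordForm_apply,
      norm_add_sq_real]
    have : inner ℝ (eucIncl m v) (stdVec (Fin.last m)) = 0 := by
      rw [stdVec, EuclideanSpace.inner_single_right, eucIncl_last]
      simp
    rw [this]
    ring
  induction x, hx using CliffordAlgebra.even_induction with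
  | algebraMap r =>
    rw [AlgHom.commutes]
    exact Algebra.commutes _ _
  | add x y hx hy h1 h2 => rw [map_add, add_mul, mul_add, h1, h2]
  | ι_mul_ι_mul v w x hx h =>
    change clIncl m (clVec v * clVec w * x) * _ = _ * clIncl m (clVec v * clVec w * x)
    rw [map_mul, map_mul, clIncl_clVec, clIncl_clVec, mul_assoc, h, ← mul_assoc, mul_assoc _ _
      (clVec (stdVec (Fin.last m))), anti w, mul_neg, ← mul_assoc, anti v]
    simp only [neg_mul, neg_neg, mul_assoc]

/-- The image of `Spin(m)` in `Spin(m+1)` acts on `ℝᵐ⁺¹ = ℝᵐ ⊕ ℝ E_{m+1}` through the action of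
`Spin(m)` on `ℝᵐ`. -/
theorem spinIncl_conj {m : ℕ} (x : Spin m) {v w : Euc m} {t t' : ℝ}
    (h : (spinIncl m x : Cl (m + 1)) * clVec (eucIncl m v + t • stdVec (Fin.last m)) =
      clVec (eucIncl m w + t' • stdVec (Fin.last m)) * (spinIncl m x : Cl (m + 1))) :
    t = t' ∧ (x : Cl m) * clVec v = clVec w * (x : Cl m) := by
  have : Invertible (2 : ℝ) := invertibleOfNonzero two_ne_zero
  obtain ⟨u, hu⟩ := spinGroup.conjAct_smul_ι_mem_range_ι (x := spinGroup.toUnits x) x.2 v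
  have hu' : (x : Cl m) * clVec v = clVec u * (x : Cl m) := by
    rw [ConjAct.units_smul_def, ConjAct.ofConjAct_toConjAct] at hu
    change clVec u = _ at hu
    rw [hu]
    change _ = (x : Cl m) * clVec v * ((spinGroup.toUnits x)⁻¹ : (Cl m)ˣ) * (spinGroup.toUnits x)
    exact (Units.inv_mul_cancel_right _ (spinGroup.toUnits x)).symm
  have hadd : ∀ (y : Euc m) (r : ℝ), clVec (eucIncl m y + r • stdVec (Fin.last m)) =
      clIncl m (clVec y) + r • clVec (stdVec (Fin.last m)) := fun y r ↦ by
    rw [clIncl_clVec]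
    exact (map_add _ _ _).trans (congrArg _ (map_smul _ _ _))
  have hB : (spinIncl m x : Cl (m + 1)) = clIncl m x := rfl
  have h1 : clVec (eucIncl m u + t • stdVec (Fin.last m)) * (spinIncl m x : Cl (m + 1)) =
      clVec (eucIncl m w + t' • stdVec (Fin.last m)) * (spinIncl m x : Cl (m + 1)) := by
    rw [← h, hadd, hadd, hB, mul_add, ← map_mul, hu', map_mul, add_mul, mul_smul_comm,
      commute_clIncl_last x.2.2, smul_mul_assoc]
  have h2 : eucIncl m u + t • stdVec (Fin.last m) = eucIncl m w + t' • stdVec (Fin.last m) :=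
    clVec_injective ((spinGroup.toUnits (spinIncl m x)).isUnit.mul_right_cancel h1)
  have h3 : t = t' := by
    have := congrArg (fun y : Euc (m + 1) ↦ y (Fin.last m)) h2
    simpa [eucIncl_last, stdVec] using this
  have h4 : u = w := by
    ext i
    have := congrArg (fun y : Euc (m + 1) ↦ y i.castSucc) h2
    simpa [eucIncl_castSucc, stdVec, Fin.castSucc_ne_last] using this
  exact ⟨h3, h4 ▸ hu'⟩

/-- A complex representation of the complexified Clifford algebra of `ℝᵏ` on a Hermitian space `S`
which is irreducible and for which unit vectors of `ℝᵏ` act isometrically. -/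
structure CliffordModule (k : ℕ) (S : Type*) [NormedAddCommGroup S] [InnerProductSpace ℂ S] where
  rep : CCl k →ₐ[ℂ] (S →L[ℂ] S)
  norm_rep_vec : ∀ (v : Euc k) (φ : S), ‖rep (1 ⊗ₜ[ℝ] clVec v) φ‖ = ‖v‖ * ‖φ‖
  nontrivial : Nontrivial S
  irreducible : ∀ p : Submodule ℂ S, (∀ x, ∀ φ ∈ p, rep x φ ∈ p) → p = ⊥ ∨ p = ⊤

namespace CliffordModule

variable {k : ℕ} {S : Type*} [NormedAddCommGroup S] [InnerProductSpace ℂ S]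

/-- The action of a real Clifford element on the module. -/
def act (R : CliffordModule k S) (x : Cl k) : S →L[ℂ] S := R.rep ((1 : ℂ) ⊗ₜ[ℝ] x)

/-- `R` is a model of the spinor module `Σ_k`: for `k` odd, `ω` acts as the identity. -/
def IsSigma (R : CliffordModule k S) : Prop := Odd k → R.rep (complexVolume k) = 1

/-- `R` is a model of the other spinor module `Σ_k^#`: `k` is odd and `ω` acts as `-1`. -/
def IsSigmaSharp (R : CliffordModule k S) : Prop := Odd k ∧ R.rep (complexVolume k) = -1

theorem act_mul (R : CliffordModule k S) (x y : Cl k) : R.act (x * y) = R.act x * R.act y := by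
  rw [act, act, act, ← map_mul, Algebra.TensorProduct.tmul_mul_tmul, one_mul]

theorem act_one (R : CliffordModule k S) : R.act 1 = 1 := by
  rw [act, ← Algebra.TensorProduct.one_def, map_one]

/-- The real-linear functional `x ↦ ℓ (x φ)` on the Clifford algebra. -/
def coeffFunctional (R : CliffordModule k S) (l : S →ₗ[ℝ] ℝ) (φ : S) : Cl k →ₗ[ℝ] ℝ where
  toFun x := l (R.act x φ)
  map_add' x y := by simp [act, TensorProduct.tmul_add]
  map_smul' c x := by
    have h : R.act (c • x) φ = c • R.act x φ := by
      have : ((1 : ℂ) ⊗ₜ[ℝ] (c • x) : CCl k) = (c : ℂ) • ((1 : ℂ) ⊗ₜ[ℝ] x) := by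
        rw [TensorProduct.tmul_smul, TensorProduct.smul_tmul', TensorProduct.smul_tmul']
        simp
      simp only [act, this, map_smul]
      simp
    simp [h]

end CliffordModule

/-- The map `(ℐ ∓ i e_n · ℐ) / √2`, where the upper sign is `s = 1` and the lower one `s = -1`. -/
def evenEmbedding {m : ℕ} {S S' : Type*} [NormedAddCommGroup S] [InnerProductSpace ℂ S]
    [NormedAddCommGroup S'] [InnerProductSpace ℂ S'] (R' : CliffordModule (m + 1) S')
    (s : ℂ) (ℐ : S →L[ℂ] S') : S →L[ℂ] S' :=
  ((1 / Real.sqrt 2 : ℝ) : ℂ) •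
    (ℐ - (s * Complex.I) • ((R'.act (clVec (stdVec (Fin.last m)))).comp ℐ))

/-- The algebraic maps between spinor modules in dimensions `m = n - 1` and `n = m + 1`.
For `n` odd these are the isometric isomorphisms of Clifford modules `J : Σ_{n-1} → Σ_n` and
`J^# : Σ_{n-1} → Σ_n^#`. For `n` even these are the four maps `J^± : Σ_{n-1} → Σ_n` and
`J^{#,±} : Σ_{n-1}^# → Σ_n` built from an isometric isomorphism of Clifford modules
`ℐ : Σ_{n-1} ⊕ Σ_{n-1}^# → Σ_n`. -/
inductive IsSpinorModuleEmbedding {m : ℕ} {S : Type u} {S' : Type v}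
    [NormedAddCommGroup S] [InnerProductSpace ℂ S]
    [NormedAddCommGroup S'] [InnerProductSpace ℂ S']
    (R : CliffordModule m S) (R' : CliffordModule (m + 1) S') : (S →L[ℂ] S') → Prop
  | odd (hn : Odd (m + 1)) (hR : R.IsSigma) (hR' : R'.IsSigma) (J : S ≃ₗᵢ[ℂ] S')
      (hJ : ∀ x φ, J (R.rep x φ) = R'.rep (cclIncl m x) (J φ)) :
      IsSpinorModuleEmbedding R R' (J : S →L[ℂ] S')
  | oddSharp (hn : Odd (m + 1)) (hR : R.IsSigma) (hR' : R'.IsSigmaSharp) (J : S ≃ₗᵢ[ℂ] S')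
      (hJ : ∀ x φ, J (R.rep x φ) = R'.rep (cclIncl m x) (J φ)) :
      IsSpinorModuleEmbedding R R' (J : S →L[ℂ] S')
  | even (hn : Even (m + 1)) (hR : R.IsSigma) (hR' : R'.IsSigma)
      (T : Type u) [NormedAddCommGroup T] [InnerProductSpace ℂ T] (Q : CliffordModule m T)
      (hQ : Q.IsSigmaSharp) (ℐ : WithLp 2 (S × T) ≃ₗᵢ[ℂ] S')
      (hℐ : ∀ x φ ψ, ℐ (WithLp.toLp 2 (R.rep x φ, Q.rep x ψ)) =
        R'.rep (cclIncl m x) (ℐ (WithLp.toLp 2 (φ, ψ))))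
      (s : ℂ) (hs : s = 1 ∨ s = -1) (ℐ₁ : S →L[ℂ] S')
      (hℐ₁ : ∀ φ, ℐ₁ φ = ℐ (WithLp.toLp 2 (φ, 0))) :
      IsSpinorModuleEmbedding R R' (evenEmbedding R' s ℐ₁)
  | evenSharp (hn : Even (m + 1)) (hR : R.IsSigmaSharp) (hR' : R'.IsSigma)
      (T : Type u) [NormedAddCommGroup T] [InnerProductSpace ℂ T] (Q : CliffordModule m T)
      (hQ : Q.IsSigma) (ℐ : WithLp 2 (T × S) ≃ₗᵢ[ℂ] S')
      (hℐ : ∀ x φ ψ, ℐ (WithLp.toLp 2 (Q.rep x φ, R.rep x ψ)) =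
        R'.rep (cclIncl m x) (ℐ (WithLp.toLp 2 (φ, ψ))))
      (s : ℂ) (hs : s = 1 ∨ s = -1) (ℐ₂ : S →L[ℂ] S')
      (hℐ₂ : ∀ ψ, ℐ₂ ψ = ℐ (WithLp.toLp 2 (0, ψ))) :
      IsSpinorModuleEmbedding R R' (evenEmbedding R' s ℐ₂)

/-! ## Spin structures and spinor bundles on Riemannian manifolds -/

/-- A smooth principal `Spin(k)`-bundle over `B`, given by an open cover with smooth local sections
`q_i` over `baseSet i` such that `q_j = q_i · transition i j`. Smoothness of the transition
functions is tested by linear functionals on the (finite-dimensional) Clifford algebra. -/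
structure SpinBundleCore (k : ℕ) {E H : Type*} [NormedAddCommGroup E] [NormedSpace ℝ E]
    [TopologicalSpace H] (I : ModelWithCorners ℝ E H) (B : Type*) [TopologicalSpace B]
    [ChartedSpace H B] (ι : Type*) where
  baseSet : ι → Set B
  isOpen_baseSet : ∀ i, IsOpen (baseSet i)
  /-- the preferred local section at a point -/
  indexAt : B → ι
  mem_baseSet_at : ∀ p, p ∈ baseSet (indexAt p)
  transition : ι → ι → B → Spin k
  transition_smooth : ∀ i j (L : Cl k →ₗ[ℝ] ℝ), ContMDiffOn I 𝓘(ℝ, ℝ) ∞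
    (fun p ↦ L (transition i j p : Cl k)) (baseSet i ∩ baseSet j)
  transition_comp : ∀ i j l, ∀ p ∈ baseSet i ∩ baseSet j ∩ baseSet l,
    transition i j p * transition j l p = transition i l p

namespace SpinBundleCore

variable {k : ℕ} {E H : Type*} [NormedAddCommGroup E] [NormedSpace ℝ E]
  [TopologicalSpace H] {I : ModelWithCorners ℝ E H} {B : Type*} [TopologicalSpace B]
  [ChartedSpace H B] {ι : Type*}
  {S : Type*} [NormedAddCommGroup S] [InnerProductSpace ℂ S] [FiniteDimensional ℂ S]

theorem transition_self (P : SpinBundleCore k I B ι) (i : ι) (p : B) (hp : p ∈ P.baseSet i) :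
    P.transition i i p = 1 := by
  have h := P.transition_comp i i i p ⟨⟨hp, hp⟩, hp⟩
  simpa using h

/-- The associated vector bundle `P ×_ρ S`. An element of the fibre over `p` is `[q_i(p), σ]`,
where `i = P.indexAt p` and `σ : S`; as `[q_i, σ] = [q_j, ρ(transition j i) σ]`, the coordinate
changes are as below. -/
def spinorBundle (P : SpinBundleCore k I B ι) (R : CliffordModule k S) :
    VectorBundleCore ℝ B S ι where
  baseSet := P.baseSet
  isOpen_baseSet := P.isOpen_baseSet
  indexAt := P.indexAt
  mem_baseSet_at := P.mem_baseSet_at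
  coordChange i j p := (R.act (P.transition j i p : Cl k)).restrictScalars ℝ
  coordChange_self i p hp v := by
    simp [P.transition_self i p hp, CliffordModule.act_one]
  continuousOn_coordChange i j := by
    rw [continuousOn_clm_apply]
    intro φ
    let b := Module.finBasis ℝ S
    have key : ContinuousOn (fun p ↦ b.equivFunL (R.act (P.transition j i p : Cl k) φ))
        (P.baseSet i ∩ P.baseSet j) := by
      rw [continuousOn_pi]
      intro a
      have := (P.transition_smooth j i (R.coeffFunctional (b.coord a) φ)).continuousOn
      rw [Set.inter_comm]
      exact this
    have h2 := b.equivFunL.symm.continuous.comp_continuousOn key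
    refine h2.congr fun p _ ↦ ?_
    simp
  coordChange_comp i j l p hp v := by
    have h := P.transition_comp l j i p ⟨⟨hp.2, hp.1.2⟩, hp.1.1⟩
    rw [← h]
    simp [CliffordModule.act_mul]

end SpinBundleCore

section Riemannian

variable {E H : Type*} [NormedAddCommGroup E] [NormedSpace ℝ E]
  [TopologicalSpace H] {I : ModelWithCorners ℝ E H} {B : Type*} [TopologicalSpace B]
  [ChartedSpace H B]

/-- `nabla` is the Levi-Civita connection of the Riemannian metric `g`: it is torsion-free and
satisfies `X (g(Y, Z)) = g(∇_X Y, Z) + g(Y, ∇_X Z)`. -/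
structure IsLeviCivita [FiniteDimensional ℝ E] [CompleteSpace E] [IsManifold I ∞ B]
    (g : ContMDiffRiemannianMetric I ∞ E (TangentSpace I : B → Type _))
    (nabla : CovariantDerivative I E (TangentSpace I : B → Type _)) : Prop where
  torsion_eq_zero : nabla.torsion = 0
  metric : ∀ (p : B) (X : TangentSpace I p) (Y Z : Π q : B, TangentSpace I q),
    MDiffAt (T% Y) p → MDiffAt (T% Z) p →
      mvfderiv I (fun q ↦ g.inner q (Y q) (Z q)) p X =
        g.inner p (nabla Y p X) (Z p) + g.inner p (Y p) (nabla Z p X)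

/-- A (smooth, oriented) spin structure on the Riemannian manifold `(B, g)` of dimension `k`: a
principal `Spin(k)`-bundle with local sections `q_i` together with its equivariant map to the bundle
of orthonormal frames. The latter is given by the smooth local orthonormal frames `frame i` which
are the images of the `q_i`; equivariance means that `frame j = frame i · λ(transition i j)`, where
`λ : Spin(k) → SO(k)` is determined by `λ(a) v = a · v · a⁻¹`.
The orientation of `B` is the one for which all the frames are positively oriented. -/
structure SpinStructure (k : ℕ) [IsManifold I ∞ B]
    (g : ContMDiffRiemannianMetric I ∞ E (TangentSpace I : B → Type _)) (ι : Type*)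
    extends SpinBundleCore k I B ι where
  finrank_eq : Module.finrank ℝ E = k
  frame : ι → Π p : B, Fin k → TangentSpace I p
  frame_smooth : ∀ i a, ContMDiffOn I I.tangent ∞
    (fun p ↦ (⟨p, frame i p a⟩ : TangentBundle I B)) (baseSet i)
  frame_orthonormal : ∀ i, ∀ p ∈ baseSet i, ∀ a b,
    g.inner p (frame i p a) (frame i p b) = if a = b then 1 else 0
  frame_transition : ∀ i j, ∀ p ∈ baseSet i ∩ baseSet j, ∀ v w : Euc k,
    (transition i j p : Cl k) * clVec v = clVec w * (transition i j p : Cl k) →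
      ∑ a, v a • frame j p a = ∑ a, w a • frame i p a

namespace SpinStructure

variable {k : ℕ} [IsManifold I ∞ B]
  {g : ContMDiffRiemannianMetric I ∞ E (TangentSpace I : B → Type _)} {ι : Type*}
  {S : Type*} [NormedAddCommGroup S] [InnerProductSpace ℂ S] [FiniteDimensional ℂ S]

/-- The fibre of the spinor bundle `P ×_ρ S` over `p`. -/
abbrev Spinor (P : SpinStructure k g ι) (R : CliffordModule k S) (p : B) : Type _ :=
  (P.spinorBundle R).Fiber p

/-- The coordinates in `ℝᵏ` of a tangent vector at `p` with respect to the preferred local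
frame at `p`. -/
def coords (P : SpinStructure k g ι) (p : B) (X : TangentSpace I p) : Euc k :=
  WithLp.toLp 2 fun a ↦ g.inner p X (P.frame (P.indexAt p) p a)

/-- Clifford multiplication of spinors by tangent vectors, `[q, v] · [q, σ] = [q, v · σ]`. -/
def cliffordMul (P : SpinStructure k g ι) (R : CliffordModule k S) (p : B)
    (X : TangentSpace I p) (φ : P.Spinor R p) : P.Spinor R p :=
  R.act (clVec (P.coords p X)) φ

/-- The function `σ` with `φ = [q_i, σ]` on `baseSet i`, for a spinor field `φ`. -/
def localRep (P : SpinStructure k g ι) (R : CliffordModule k S) (φ : Π p, P.Spinor R p)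
    (i : ι) (p : B) : S :=
  (P.spinorBundle R).coordChange (P.indexAt p) i p (φ p)

/-- The covariant derivative on the spinor bundle induced by a metric connection `nabla` on the
tangent bundle: for a local section `q` of the `Spin(k)`-bundle lying over the orthonormal frame
`(e_1, …, e_k)`,
`∇_X [q, σ] = [q, ∂_X σ + ¼ ∑_{a,b} g(∇_X e_a, e_b) E_a · E_b · σ]`.
At `p` it is computed with the preferred local section at `p`. -/
def spinorDeriv (P : SpinStructure k g ι)
    (nabla : CovariantDerivative I E (TangentSpace I : B → Type _)) (R : CliffordModule k S)
    (φ : Π p, P.Spinor R p) (p : B) (X : TangentSpace I p) : P.Spinor R p :=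
  let i := P.indexAt p
  let σ : B → S := P.localRep R φ i
  let Γ : Fin k → Fin k → ℝ := fun a b ↦
    g.inner p (nabla (fun q ↦ P.frame i q a) p X) (P.frame i p b)
  (mvfderiv I σ p X +
    (1 / 4 : ℝ) • ∑ a, ∑ b, Γ a b • R.act (clVec (stdVec a) * clVec (stdVec b)) (σ p) : S)

end SpinStructure

end Riemannian

/-! ## Generalised cylinders -/

/-- The open interval `(a, b)`. -/
def openInterval (a b : EReal) : Opens ℝ :=
  ⟨{s : ℝ | a < (s : EReal) ∧ (s : EReal) < b},
    (isOpen_lt continuous_const continuous_coe_real_ereal).inter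
      (isOpen_lt continuous_coe_real_ereal continuous_const)⟩

/-- The manifold `N = M × (a, b)`. -/
abbrev Cylinder (M : Type*) (a b : EReal) : Type _ := M × openInterval a b

/-- The model with corners of `M × (a, b)`. -/
abbrev cylModel (m : ℕ) : ModelWithCorners ℝ (Euc m × ℝ) (ModelProd (Euc m) ℝ) :=
  (𝓡 m).prod 𝓘(ℝ, ℝ)

section Cylinder

variable {m : ℕ} {a b : EReal} {M : Type*} [TopologicalSpace M] [ChartedSpace (Euc m) M]

/-- A vector of `T_x M`, viewed as a vector of `T_{(x,s)} (M × {s}) ⊂ T_{(x,s)} N`. -/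
def vert (p : Cylinder M a b) (v : TangentSpace (𝓡 m) p.1) : TangentSpace (cylModel m) p :=
  ((v, 0) : Euc m × ℝ)

/-- The unit normal field `ν = ∂/∂s` of the slices. -/
def nu (p : Cylinder M a b) : TangentSpace (cylModel m) p := ((0, 1) : Euc m × ℝ)

theorem vert_zero (p : Cylinder M a b) : vert p (0 : TangentSpace (𝓡 m) p.1) = 0 := rfl

theorem vert_add (p : Cylinder M a b) (v w : TangentSpace (𝓡 m) p.1) :
    vert p (v + w) = vert p v + vert p w := by
  refine Prod.ext rfl ?_
  change (0 : ℝ) = 0 + 0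
  simp

theorem vert_smul (p : Cylinder M a b) (c : ℝ) (v : TangentSpace (𝓡 m) p.1) :
    vert p (c • v) = c • vert p v := by
  refine Prod.ext rfl ?_
  change (0 : ℝ) = c • 0
  simp

theorem vert_sum (p : Cylinder M a b) {κ : Type*} [Fintype κ] (v : κ → TangentSpace (𝓡 m) p.1) :
    vert p (∑ c, v c) = ∑ c, vert p (v c) :=
  map_sum (⟨⟨vert p, vert_zero p⟩, vert_add p⟩ :
    TangentSpace (𝓡 m) p.1 →+ TangentSpace (cylModel m) p) v Finset.univ

theorem contMDiff_slice (s : openInterval a b) :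
    ContMDiff (𝓡 m) (cylModel m) ∞ (fun x : M ↦ ((x, s) : Cylinder M a b)) :=
  contMDiff_id.prodMk contMDiff_const

variable [IsManifold (𝓡 m) ∞ M]

/-- The metric `h` on `N = M × (a, b)` is `g_s + ds²`. -/
def IsCylinderMetric
    (g : openInterval a b →
      ContMDiffRiemannianMetric (𝓡 m) ∞ (Euc m) (TangentSpace (𝓡 m) : M → Type _))
    (h : ContMDiffRiemannianMetric (cylModel m) ∞ (Euc m × ℝ)
      (TangentSpace (cylModel m) : Cylinder M a b → Type _)) : Prop :=
  ∀ (p : Cylinder M a b) (v w : TangentSpace (𝓡 m) p.1) (t u : ℝ),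
    h.inner p (vert p v + t • nu p) (vert p w + u • nu p) = (g p.2).inner p.1 v w + t * u

/-- The bundle `P_{Spin,M}(N) → N`: a principal `Spin(m)`-bundle over `N = M × (a, b)` with its
equivariant map to the bundle of `g_s`-orthonormal frames of the vertical bundle
`T_M N = ∐ T(M × {s})`. -/
structure VerticalSpinStructure
    (g : openInterval a b →
      ContMDiffRiemannianMetric (𝓡 m) ∞ (Euc m) (TangentSpace (𝓡 m) : M → Type _)) (ι : Type*)
    extends SpinBundleCore m (cylModel m) (Cylinder M a b) ι where
  frame : ι → Π p : Cylinder M a b, Fin m → TangentSpace (𝓡 m) p.1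
  frame_smooth : ∀ i c, ContMDiffOn (cylModel m) (cylModel m).tangent ∞
    (fun p ↦ (⟨p, vert p (frame i p c)⟩ : TangentBundle (cylModel m) (Cylinder M a b))) (baseSet i)
  frame_orthonormal : ∀ i, ∀ p ∈ baseSet i, ∀ c d,
    (g p.2).inner p.1 (frame i p c) (frame i p d) = if c = d then 1 else 0
  frame_transition : ∀ i j, ∀ p ∈ baseSet i ∩ baseSet j, ∀ v w : Euc m,
    (transition i j p : Cl m) * clVec v = clVec w * (transition i j p : Cl m) →
      ∑ c, v c • frame j p c = ∑ c, w c • frame i p c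

namespace VerticalSpinStructure

variable {ι : Type*} {g : openInterval a b →
      ContMDiffRiemannianMetric (𝓡 m) ∞ (Euc m) (TangentSpace (𝓡 m) : M → Type _)}
  {h : ContMDiffRiemannianMetric (cylModel m) ∞ (Euc m × ℝ)
      (TangentSpace (cylModel m) : Cylinder M a b → Type _)}

theorem contMDiff_unit : ContMDiff 𝓘(ℝ, ℝ) (𝓘(ℝ, ℝ)).tangent ∞
    (fun s ↦ (⟨s, (1 : ℝ)⟩ : TangentBundle 𝓘(ℝ, ℝ) (openInterval a b))) := by
  intro s₀
  rw [contMDiffAt_totalSpace]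
  refine ⟨contMDiffAt_id, ?_⟩
  refine (contMDiffAt_const (c := (1 : ℝ))).congr_of_eventuallyEq ?_
  filter_upwards with s
  have hs : achart ℝ s₀ = achart ℝ s := rfl
  change (tangentBundleCore 𝓘(ℝ, ℝ) (openInterval a b)).coordChange (achart ℝ s) (achart ℝ s₀) s 1
    = 1
  rw [hs]
  exact (tangentBundleCore 𝓘(ℝ, ℝ) (openInterval a b)).coordChange_self (achart ℝ s) s
    (mem_chart_source ℝ s) 1

theorem contMDiff_nu : ContMDiff (cylModel m) (cylModel m).tangent ∞
    (fun p ↦ (⟨p, nu p⟩ : TangentBundle (cylModel m) (Cylinder M a b))) := by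
  have h1 : ContMDiff (cylModel m) (𝓡 m).tangent ∞
      (fun p : Cylinder M a b ↦ (⟨p.1, 0⟩ : TangentBundle (𝓡 m) M)) :=
    (contMDiff_zeroSection ℝ (TangentSpace (𝓡 m) : M → Type _)).comp contMDiff_fst
  have h2 : ContMDiff (cylModel m) (𝓘(ℝ, ℝ)).tangent ∞
      (fun p : Cylinder M a b ↦ (⟨p.2, (1 : ℝ)⟩ : TangentBundle 𝓘(ℝ, ℝ) (openInterval a b))) :=
    contMDiff_unit.comp contMDiff_snd
  exact (contMDiff_equivTangentBundleProd_symm (I := 𝓡 m) (I' := 𝓘(ℝ, ℝ)) (M := M)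
    (M' := openInterval a b)).comp (h1.prodMk h2)

/-- The spin structure on the slice `(M, g_s)`. -/
def slice (P : VerticalSpinStructure g ι) (s : openInterval a b) : SpinStructure m (g s) ι where
  baseSet i := {x | (x, s) ∈ P.baseSet i}
  isOpen_baseSet i := (P.isOpen_baseSet i).preimage (by fun_prop)
  indexAt x := P.indexAt (x, s)
  mem_baseSet_at x := P.mem_baseSet_at (x, s)
  transition i j x := P.transition i j (x, s)
  transition_smooth i j L :=
    (P.transition_smooth i j L).comp (contMDiff_slice s).contMDiffOn fun _ hx ↦ hx
  transition_comp i j l x hx := P.transition_comp i j l (x, s) hx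
  finrank_eq := by simp
  frame i x c := P.frame i (x, s) c
  frame_smooth i c := by
    have h1 := (P.frame_smooth i c).comp (contMDiff_slice s).contMDiffOn
      (fun x (hx : x ∈ {x | (x, s) ∈ P.baseSet i}) ↦ hx)
    have h2 := ((contMDiff_fst (I := 𝓡 m) (J := 𝓘(ℝ, ℝ)) (M := M) (N := openInterval a b)
      (n := ∞)).contMDiff_tangentMap (m := ∞) le_rfl).comp_contMDiffOn h1
    refine h2.congr fun x _ ↦ ?_
    simp only [Function.comp_apply, tangentMap_prodFst]
    rfl
  frame_orthonormal i x hx c d := P.frame_orthonormal i (x, s) hx c d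
  frame_transition i j x hx v w hvw := P.frame_transition i j (x, s) hx v w hvw

/-- The spin structure `P_{Spin}(N) = P_{Spin,M}(N) ×_{Spin(m)} Spin(m+1)` on `(N, h)`; the
section induced by a local section of `P_{Spin,M}(N)` over the frame `(e_1, …, e_m)` lies over the
frame `(e_1, …, e_m, ν)`. -/
def total (P : VerticalSpinStructure g ι) (hgh : IsCylinderMetric g h) :
    SpinStructure (m + 1) h ι where
  baseSet := P.baseSet
  isOpen_baseSet := P.isOpen_baseSet
  indexAt := P.indexAt
  mem_baseSet_at := P.mem_baseSet_at
  transition i j p := spinIncl m (P.transition i j p)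
  transition_smooth i j L := P.transition_smooth i j (L.comp (clIncl m).toLinearMap)
  transition_comp i j l p hp := by
    rw [← map_mul, P.transition_comp i j l p hp]
  finrank_eq := by simp
  frame i p := Fin.snoc (α := fun _ ↦ TangentSpace (cylModel m) p)
    (fun c ↦ vert p (P.frame i p c)) (nu p)
  frame_smooth i c := by
    refine Fin.lastCases ?_ (fun c ↦ ?_) c
    · simpa using contMDiff_nu.contMDiffOn
    · simpa using P.frame_smooth i c
  frame_orthonormal i p hp c d := by
    have h1 : ∀ v : TangentSpace (𝓡 m) p.1, vert p v = vert p v + (0 : ℝ) • nu p := fun v ↦ by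
      simp
    have h2 : (nu p : TangentSpace (cylModel m) p) = vert p 0 + (1 : ℝ) • nu p := by
      rw [vert_zero, zero_add, one_smul]
    refine Fin.lastCases ?_ (fun c ↦ ?_) c <;> refine Fin.lastCases ?_ (fun d ↦ ?_) d
    · simp only [Fin.snoc_last, if_true]
      rw [h2, hgh]
      simp
    · simp only [Fin.snoc_last, Fin.snoc_castSucc]
      rw [h2, h1 (P.frame i p d), hgh]
      simp [(Fin.castSucc_ne_last d).symm]
    · simp only [Fin.snoc_last, Fin.snoc_castSucc]
      rw [h2, h1 (P.frame i p c), hgh]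
      simp [Fin.castSucc_ne_last c]
    · simp only [Fin.snoc_castSucc]
      rw [h1 (P.frame i p c), h1 (P.frame i p d), hgh]
      simp [P.frame_orthonormal i p hp]
  frame_transition i j p hp v w hvw := by
    obtain ⟨v', t, rfl⟩ := exists_eucIncl_add v
    obtain ⟨w', t', rfl⟩ := exists_eucIncl_add w
    obtain ⟨rfl, h1⟩ := spinIncl_conj (P.transition i j p) hvw
    have h2 := P.frame_transition i j p hp v' w' h1
    have key : ∀ (q : ι) (u : Euc m), (∑ c, (eucIncl m u + t • stdVec (Fin.last m)) c •
        (Fin.snoc (α := fun _ ↦ TangentSpace (cylModel m) p)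
          (fun c ↦ vert p (P.frame q p c)) (nu p) : Fin (m + 1) → TangentSpace (cylModel m) p) c) =
        vert p (∑ c, u c • P.frame q p c) + t • nu p := fun q u ↦ by
      rw [Fin.sum_univ_castSucc, vert_sum]
      simp [eucIncl_castSucc, eucIncl_last, stdVec, vert_smul, Fin.castSucc_ne_last]
    rw [key, key, h2]

variable {S S' : Type*} [NormedAddCommGroup S] [InnerProductSpace ℂ S] [FiniteDimensional ℂ S]
  [NormedAddCommGroup S'] [InnerProductSpace ℂ S'] [FiniteDimensional ℂ S']

/-- The fibre over `p = (x, s)` of the bundle `Σ_M N = P_{Spin,M}(N) ×_ρ S = ∐ Σ^{g_s} M`. -/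
abbrev Spinor (P : VerticalSpinStructure g ι) (R : CliffordModule m S) (p : Cylinder M a b) :
    Type _ :=
  (P.spinorBundle R).Fiber p

/-- The section `φ` of `Σ_M N` is smooth. -/
def IsSmoothSpinorField (P : VerticalSpinStructure g ι) (R : CliffordModule m S)
    (φ : Π p, P.Spinor R p) : Prop :=
  ContMDiff (cylModel m) ((cylModel m).prod 𝓘(ℝ, S)) ∞
    (fun p ↦ (⟨p, φ p⟩ : TotalSpace S (P.spinorBundle R).Fiber))

/-- The restriction of a section of `Σ_M N` to the slice `M × {s}`, a section of `Σ^{g_s} M`. -/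
def restrictSpinor (P : VerticalSpinStructure g ι) (R : CliffordModule m S)
    (φ : Π p, P.Spinor R p) (s : openInterval a b) : Π x, (P.slice s).Spinor R x :=
  fun x ↦ φ (x, s)

/-- The partial connection `∇^{M,g_s}` on `Σ_M N`: differentiation in the direction of `X ∈ T_x M`
at `p = (x, s)` with the spinorial connection of `(M, g_s)`. -/
def sliceSpinorDeriv (P : VerticalSpinStructure g ι)
    (nablaM : openInterval a b → CovariantDerivative (𝓡 m) (Euc m)
      (TangentSpace (𝓡 m) : M → Type _))
    (R : CliffordModule m S) (φ : Π p, P.Spinor R p) (p : Cylinder M a b)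
    (X : TangentSpace (𝓡 m) p.1) : P.Spinor R p :=
  (P.slice p.2).spinorDeriv (nablaM p.2) R (P.restrictSpinor R φ p.2) p.1 X

/-- The bundle map `Σ_M N → Σ N` induced by an algebraic map `j` between the spinor modules:
it sends `[q, σ]` to `[q, j σ]`, where on the right `q` is viewed in `P_{Spin}(N)`. -/
def embedSpinor (P : VerticalSpinStructure g ι) (hgh : IsCylinderMetric g h)
    (R : CliffordModule m S) (R' : CliffordModule (m + 1) S') (j : S →L[ℂ] S')
    (p : Cylinder M a b) (φ : P.Spinor R p) : (P.total hgh).Spinor R' p :=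
  j φ

end VerticalSpinStructure

/-- `W` is the Weingarten map of the slices: `g_s(W(X), Y) ν = ∇^N_X Y - ∇^{M,g_s}_X Y` for all
`X` and all (locally defined) smooth sections `Y` of `T_M N`. -/
def IsWeingartenMap
    (g : openInterval a b →
      ContMDiffRiemannianMetric (𝓡 m) ∞ (Euc m) (TangentSpace (𝓡 m) : M → Type _))
    (nablaM : openInterval a b → CovariantDerivative (𝓡 m) (Euc m)
      (TangentSpace (𝓡 m) : M → Type _))
    (nablaN : CovariantDerivative (cylModel m) (Euc m × ℝ)
      (TangentSpace (cylModel m) : Cylinder M a b → Type _))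
    (W : Π p : Cylinder M a b, TangentSpace (𝓡 m) p.1 →L[ℝ] TangentSpace (𝓡 m) p.1) : Prop :=
  ∀ (p : Cylinder M a b) (X : TangentSpace (𝓡 m) p.1)
    (Y : Π q : Cylinder M a b, TangentSpace (𝓡 m) q.1),
    ContMDiffAt (cylModel m) (cylModel m).tangent ∞
      (fun q ↦ (⟨q, vert q (Y q)⟩ : TangentBundle (cylModel m) (Cylinder M a b))) p →
    (g p.2).inner p.1 (W p X) (Y p) • nu p =
      nablaN (fun q ↦ vert q (Y q)) p (vert p X) -
        vert p (nablaM p.2 (fun x ↦ Y (x, p.2)) p.1 X)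

end Cylinder

end

noncomputable section

/-! The argument has a Riemannian half, the Gauss formula for the slices, and an algebraic half, the
comparison of two Clifford actions.

Riemannian half. For vertical fields that do not depend on `s`, the Lie bracket on the cylinder is
the bracket on `M` (`mlieBracket_vert`), and `h` restricts to `g_s` on each slice. The difference
between the tangential part of `∇^N` and `∇^{M,g_s}` is therefore symmetric in its first two
arguments and skew in its last two, hence zero. Metric compatibility alone extends this to vertical
fields depending on `s`, because both sides see only the restriction to the slice
(`inner_nablaN_vert`). For the normal part, differentiating `h(Y, ν) = 0` gives `h(∇_X Y, ν) =
-h(∇_X ν, Y)`, and differentiating `h(ν, ν) = 1` shows that `∇_X ν` is vertical. So `X ↦ -∇_X ν` is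
a Weingarten map. Uniqueness follows by testing against fields with arbitrary prescribed value at a
point.

Algebraic half. For `n` even the maps between spinor modules are not linear over the whole of `Cl
m`, since `E_n` anticommutes with vectors of `ℝᵐ`. They are linear over its even part
(`IsSpinorModuleEmbedding.map_act`), and this suffices: transition functions lie in `Spin(m)`, and
connection terms contain only products `E_a · E_b`.

Conclusion. In the adapted frame `(e_1, …, e_m, ν)`, the connection matrix of `∇^N` in a vertical
direction is that of `∇^{M,g_s}` bordered by the components `w_c` of `W(X)` in the last column and
`-w_c` in the last row. The inner block reproduces the slice connection. The two borders contribute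
equally, because `E_n · E_c = -E_c · E_n`, so they give `¼ · 2 = ½` times `W(X) ⋆ ν`
(`sum_connection_act`, `spinorDeriv_embedSpinor`). -/

theorem lieBracket_prod_zero {E F : Type*} [NormedAddCommGroup E] [NormedSpace ℝ E]
    [NormedAddCommGroup F] [NormedSpace ℝ F] {V W : E × F → E × F} {X Y : E → E} {z : E × F}
    (hX : DifferentiableAt ℝ X z.1) (hY : DifferentiableAt ℝ Y z.1)
    (hV : V =ᶠ[nhds z] fun w ↦ (X w.1, 0)) (hW : W =ᶠ[nhds z] fun w ↦ (Y w.1, 0)) :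
    VectorField.lieBracket ℝ V W z = (VectorField.lieBracket ℝ X Y z.1, 0) := by
  have key : ∀ {Z : E → E}, DifferentiableAt ℝ Z z.1 → ∀ v : E × F,
      fderiv ℝ (fun w : E × F ↦ ((Z w.1, 0) : E × F)) z v = (fderiv ℝ Z z.1 v.1, 0) := by
    intro Z hZ v
    have h := (hZ.hasFDerivAt.comp z (hasFDerivAt_fst (𝕜 := ℝ))).prodMk
      (hasFDerivAt_const (0 : F) z)
    have h' : HasFDerivAt (fun w : E × F ↦ ((Z w.1, 0) : E × F)) _ z := h
    rw [h'.fderiv]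
    rfl
  rw [VectorField.lieBracket, VectorField.lieBracket, hV.fderiv_eq, hW.fderiv_eq, hV.eq_of_nhds,
    hW.eq_of_nhds, key hX, key hY]
  simp

/-! ### Vector fields and Lie brackets read in a chart. -/

section ChartCoordinates

variable {E H : Type*} [NormedAddCommGroup E] [NormedSpace ℝ E] [TopologicalSpace H]
  (I : ModelWithCorners ℝ E H) {M : Type*} [TopologicalSpace M] [ChartedSpace H M]

/-- A vector field read in the preferred chart at `x`. -/
def chartField (x : M) (X : Π y : M, TangentSpace I y) (e : E) : E :=
  (mfderivWithin 𝓘(ℝ, E) I (extChartAt I x).symm (Set.range I) e).inverse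
    (X ((extChartAt I x).symm e))

variable {I} [I.Boundaryless]

theorem differentiableAt_chartField [CompleteSpace E] [IsManifold I 2 M] {x : M} {X : Π y : M, TangentSpace I y}
    (hX : MDifferentiableAt I I.tangent (fun y ↦ (⟨y, X y⟩ : TangentBundle I M)) x) :
    DifferentiableAt ℝ (chartField I x X) (extChartAt I x x) := by
  have h := (mdifferentiableWithinAt_univ.2 hX)
    |>.differentiableWithinAt_mpullbackWithin_vectorField
  have r : (extChartAt I x).symm ⁻¹' Set.univ ∩ Set.range I = Set.univ := by
    simp [I.range_eq_univ]
  rw [r] at h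
  exact h.differentiableAt Filter.univ_mem

/-- The bracket on a manifold is by definition the bracket in the chart, pulled back by the inverse
of the differential of the chart. Here that inverse is replaced by the differential of the inverse
chart, which can be computed on a product. -/
theorem mlieBracket_eq_mfderivWithin_chartField [IsManifold I 1 M] (x : M)
    (X Y : Π y : M, TangentSpace I y) :
    VectorField.mlieBracket I X Y x =
      mfderivWithin 𝓘(ℝ, E) I (extChartAt I x).symm (Set.range I) (extChartAt I x x)
        (VectorField.lieBracket (E := E) ℝ (chartField I x X) (chartField I x Y) (extChartAt I x x)) := by
  have r : (extChartAt I x).symm ⁻¹' Set.univ ∩ Set.range I = Set.univ := by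
    simp [I.range_eq_univ]
  have h : VectorField.mlieBracket I X Y x = (mfderiv I 𝓘(ℝ, E) (extChartAt I x) x).inverse
      (VectorField.lieBracketWithin (E := E) ℝ (chartField I x X) (chartField I x Y)
        ((extChartAt I x).symm ⁻¹' Set.univ ∩ Set.range I) (extChartAt I x x)) := rfl
  rw [h, r, VectorField.lieBracketWithin_univ]
  refine ((isInvertible_mfderiv_extChartAt (mem_extChartAt_source x)).inverse_apply_eq).2 ?_
  have h2 := mfderiv_extChartAt_comp_mfderivWithin_extChartAt_symm (I := I)
    (mem_extChartAt_target x)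
  have h3 := congrArg (fun L ↦ L (VectorField.lieBracket (E := E) ℝ (chartField I x X)
    (chartField I x Y) (extChartAt I x x))) h2
  have hx : (extChartAt I x).symm (extChartAt I x x) = x := extChartAt_to_inv x
  refine Eq.trans ?_ (h3.symm.trans ?_)
  · rfl
  -- The two differentials of the chart are based at points that are equal but not definitionally
  -- so.
  · change mfderiv I 𝓘(ℝ, E) (extChartAt I x) ((extChartAt I x).symm (extChartAt I x x)) _ = _
    congr 1 
    rw [hx]

end ChartCoordinates

/-! ### Lie brackets of vertical fields on the cylinder. -/

section CylinderCalculus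

variable {m : ℕ} {a b : EReal} {M : Type*} [TopologicalSpace M] [ChartedSpace (Euc m) M]

theorem mfderiv_slice (p : Cylinder M a b) (X : TangentSpace (𝓡 m) p.1) :
    mfderiv (𝓡 m) (cylModel m) (fun x : M ↦ ((x, p.2) : Cylinder M a b)) p.1 X = vert p X := by
  rw [mfderiv_prod_left]
  rfl

variable [IsManifold (𝓡 m) ∞ M]

/-- The chart of a product is the product of the charts, so the differential of its inverse is block
diagonal and preserves vertical vectors. -/
theorem mfderivWithin_extChartAt_symm_vert (p : Cylinder M a b) {z : Euc m × ℝ}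
    (hz : z ∈ (extChartAt (cylModel m) p).target) (v : Euc m) :
    mfderivWithin 𝓘(ℝ, Euc m × ℝ) (cylModel m) (extChartAt (cylModel m) p).symm
        (Set.range (cylModel m)) z ((v, 0) : Euc m × ℝ) =
      vert ((extChartAt (cylModel m) p).symm z)
        (mfderivWithin 𝓘(ℝ, Euc m) (𝓡 m) (extChartAt (𝓡 m) p.1).symm (Set.range (𝓡 m)) z.1 v) := by
  have hz' := hz
  rw [extChartAt_prod, PartialEquiv.prod_target] at hz'
  have d₁ := (mdifferentiableWithinAt_of_isInvertible_mfderivWithin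
    (isInvertible_mfderivWithin_extChartAt_symm (I := 𝓡 m) hz'.1)).hasMFDerivWithinAt
  have d₂ := (mdifferentiableWithinAt_of_isInvertible_mfderivWithin
    (isInvertible_mfderivWithin_extChartAt_symm (I := 𝓘(ℝ, ℝ)) hz'.2)).hasMFDerivWithinAt
  have f₁ : HasMFDerivAt 𝓘(ℝ, Euc m × ℝ) 𝓘(ℝ, Euc m) (Prod.fst : Euc m × ℝ → Euc m) z
    (ContinuousLinearMap.fst ℝ (Euc m) ℝ) := hasFDerivAt_fst.hasMFDerivAt
  have f₂ : HasMFDerivAt 𝓘(ℝ, Euc m × ℝ) 𝓘(ℝ, ℝ) (Prod.snd : Euc m × ℝ → ℝ) z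
    (ContinuousLinearMap.snd ℝ (Euc m) ℝ) := hasFDerivAt_snd.hasMFDerivAt
  have c := (d₁.comp z (f₁.hasMFDerivWithinAt (s := Set.range (cylModel m))) (by simp)).prodMk
    (d₂.comp z (f₂.hasMFDerivWithinAt (s := Set.range (cylModel m))) (by simp))
  have e : mfderivWithin 𝓘(ℝ, Euc m × ℝ) (cylModel m) (extChartAt (cylModel m) p).symm
      (Set.range (cylModel m)) z = _ :=
    c.mfderivWithin (by simpa using uniqueMDiffWithinAt_univ ..)
  rw [e]
  refine Prod.ext rfl ?_
  exact map_zero (mfderivWithin 𝓘(ℝ, ℝ) 𝓘(ℝ, ℝ) (extChartAt 𝓘(ℝ, ℝ) p.2).symm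
      (Set.range 𝓘(ℝ, ℝ)) z.2)

theorem chartField_vert (p : Cylinder M a b) (X : Π x : M, TangentSpace (𝓡 m) x) {z : Euc m × ℝ}
    (hz : z ∈ (extChartAt (cylModel m) p).target) :
    chartField (cylModel m) p (fun q ↦ vert q (X q.1)) z = (chartField (𝓡 m) p.1 X z.1, 0) := by
  have hz' := hz
  rw [extChartAt_prod, PartialEquiv.prod_target] at hz'
  refine ((isInvertible_mfderivWithin_extChartAt_symm (I := cylModel m) hz).inverse_apply_eq).2 ?_
  refine Eq.trans ?_ (mfderivWithin_extChartAt_symm_vert p hz (chartField (𝓡 m) p.1 X z.1)).symm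
  exact congrArg (vert ((extChartAt (cylModel m) p).symm z))
    ((isInvertible_mfderivWithin_extChartAt_symm (I := 𝓡 m) hz'.1).self_apply_inverse _).symm

/-- The Lie bracket of `s`-independent vertical fields is computed in `M`. -/
theorem mlieBracket_vert {p : Cylinder M a b} {X Y : Π x : M, TangentSpace (𝓡 m) x}
    (hX : MDifferentiableAt (𝓡 m) (𝓡 m).tangent (fun x ↦ (⟨x, X x⟩ : TangentBundle (𝓡 m) M)) p.1)
    (hY : MDifferentiableAt (𝓡 m) (𝓡 m).tangent (fun x ↦ (⟨x, Y x⟩ : TangentBundle (𝓡 m) M)) p.1) :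
    VectorField.mlieBracket (cylModel m) (fun q : Cylinder M a b ↦ vert q (X q.1))
      (fun q ↦ vert q (Y q.1)) p = vert p (VectorField.mlieBracket (𝓡 m) X Y p.1) := by
  have hp : extChartAt (cylModel m) p p ∈ (extChartAt (cylModel m) p).target :=
    mem_extChartAt_target p
  have hp1 : (extChartAt (cylModel m) p p).1 = extChartAt (𝓡 m) p.1 p.1 := rfl
  have ev : ∀ Z : Π x : M, TangentSpace (𝓡 m) x,
      chartField (cylModel m) p (fun q ↦ vert q (Z q.1)) =ᶠ[nhds (extChartAt (cylModel m) p p)]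
        fun z ↦ (chartField (𝓡 m) p.1 Z z.1, 0) := fun Z ↦ by
    filter_upwards [extChartAt_target_mem_nhds p] with z hz using chartField_vert p Z hz
  rw [mlieBracket_eq_mfderivWithin_chartField, mlieBracket_eq_mfderivWithin_chartField,
    lieBracket_prod_zero (differentiableAt_chartField hX) (differentiableAt_chartField hY)
      (ev X) (ev Y)]
  refine (mfderivWithin_extChartAt_symm_vert p hp _).trans ?_
  rw [extChartAt_to_inv p]
  rfl

end CylinderCalculus

/-! ### Differentiability and nondegeneracy of a Riemannian metric. -/

section MetricDifferentiability

variable {E H : Type*} [NormedAddCommGroup E] [NormedSpace ℝ E] [TopologicalSpace H]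
  {I : ModelWithCorners ℝ E H} {B : Type*} [TopologicalSpace B] [ChartedSpace H B]
  [IsManifold I ∞ B]

theorem mdifferentiableAt_inner
    (g : ContMDiffRiemannianMetric I ∞ E (TangentSpace I : B → Type _))
    {V W : Π q : B, TangentSpace I q} {p : B}
    (hV : MDifferentiableAt I I.tangent (fun q ↦ (⟨q, V q⟩ : TangentBundle I B)) p)
    (hW : MDifferentiableAt I I.tangent (fun q ↦ (⟨q, W q⟩ : TangentBundle I B)) p) :
    MDifferentiableAt I 𝓘(ℝ, ℝ) (fun q ↦ g.inner q (V q) (W q)) p := by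
  -- The fibres receive the inner product of `g` locally, so that the differentiability result for
  -- Riemannian bundles applies to a metric given as data.
  let : RiemannianBundle (TangentSpace I : B → Type _) := ⟨g.toRiemannianMetric⟩
  exact MDifferentiableAt.inner_bundle (F := E) (E := (TangentSpace I : B → Type _)) hV hW

theorem eq_of_forall_inner_eq
    (g : ContMDiffRiemannianMetric I ∞ E (TangentSpace I : B → Type _)) {p : B}
    {v w : TangentSpace I p} (h : ∀ u, g.inner p v u = g.inner p w u) : v = w := by
  by_contra hne
  have h1 := g.pos p (v - w) (sub_ne_zero.2 hne)
  have h2 : g.inner p (v - w) (v - w) = 0 := by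
    rw [map_sub (g.inner p) v w, sub_apply, h, sub_self]
  exact h1.ne' h2

end MetricDifferentiability

/-! ### Vertical fields and the orthogonal splitting of the tangent bundle of the cylinder. -/

section CylinderFields

variable {m : ℕ} {a b : EReal} {M : Type*} [TopologicalSpace M] [ChartedSpace (Euc m) M]

/-- The projection of `T_p N` onto the tangent space of the slice. -/
def vertProj (p : Cylinder M a b) : TangentSpace (cylModel m) p →L[ℝ] TangentSpace (𝓡 m) p.1 :=
  ContinuousLinearMap.fst ℝ (Euc m) ℝ

/-- The `ν`-component of a vector of `T_p N`. -/
def nuCoord (p : Cylinder M a b) : TangentSpace (cylModel m) p →L[ℝ] ℝ :=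
  ContinuousLinearMap.snd ℝ (Euc m) ℝ

theorem vert_vertProj_add (p : Cylinder M a b) (v : TangentSpace (cylModel m) p) :
    vert p (vertProj p v) + nuCoord p v • nu p = v := by
  refine Prod.ext ?_ ?_
  · change (v : Euc m × ℝ).1 + (v : Euc m × ℝ).2 • (0 : Euc m) = (v : Euc m × ℝ).1
    simp
  · change 0 + (v : Euc m × ℝ).2 • (1 : ℝ) = (v : Euc m × ℝ).2
    simp

theorem mvfderiv_comp_slice {F : Type*} [NormedAddCommGroup F] [NormedSpace ℝ F]
    {f : Cylinder M a b → F} {p : Cylinder M a b}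
    (hf : MDifferentiableAt (cylModel m) 𝓘(ℝ, F) f p) (X : TangentSpace (𝓡 m) p.1) :
    mvfderiv (𝓡 m) (fun x : M ↦ f (x, p.2)) p.1 X = mvfderiv (cylModel m) f p (vert p X) := by
  have hs : MDifferentiableAt (𝓡 m) (cylModel m) (fun x : M ↦ ((x, p.2) : Cylinder M a b)) p.1 :=
    (contMDiff_slice p.2).mdifferentiableAt (by simp)
  have h1 := mfderiv_comp_apply (I := 𝓡 m) (I' := cylModel m) (I'' := 𝓘(ℝ, F)) p.1
    (f := fun x : M ↦ ((x, p.2) : Cylinder M a b)) (g := f) hf hs X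
  rw [mfderiv_slice] at h1
  exact h1

variable [IsManifold (𝓡 m) ∞ M]

/-- Under the splitting of the tangent bundle of a product, the lift of `X` is the pair of `X` and
the zero section. These lifts, constant in `s`, serve as test fields. -/
theorem contMDiffAt_vert {p : Cylinder M a b} {X : Π x : M, TangentSpace (𝓡 m) x}
    (hX : ContMDiffAt (𝓡 m) (𝓡 m).tangent ∞
      (fun x ↦ (⟨x, X x⟩ : TangentBundle (𝓡 m) M)) p.1) :
    ContMDiffAt (cylModel m) (cylModel m).tangent ∞
      (fun q ↦ (⟨q, vert q (X q.1)⟩ : TangentBundle (cylModel m) (Cylinder M a b))) p := by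
  have h1 : ContMDiffAt (cylModel m) (𝓡 m).tangent ∞
      (fun q : Cylinder M a b ↦ (⟨q.1, X q.1⟩ : TangentBundle (𝓡 m) M)) p :=
    ContMDiffAt.comp p hX contMDiff_fst.contMDiffAt
  have h2 : ContMDiff (cylModel m) (𝓘(ℝ, ℝ)).tangent ∞
      (fun p : Cylinder M a b ↦ (⟨p.2, (0 : ℝ)⟩ : TangentBundle 𝓘(ℝ, ℝ) (openInterval a b))) :=
    (contMDiff_zeroSection ℝ (TangentSpace 𝓘(ℝ, ℝ) : openInterval a b → Type _)).comp contMDiff_snd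
  exact (contMDiff_equivTangentBundleProd_symm (I := 𝓡 m) (I' := 𝓘(ℝ, ℝ)) (M := M)
    (M' := openInterval a b)).contMDiffAt.comp p (h1.prodMk h2.contMDiffAt)

theorem mdifferentiableAt_vert {p : Cylinder M a b} {X : Π x : M, TangentSpace (𝓡 m) x}
    (hX : MDifferentiableAt (𝓡 m) (𝓡 m).tangent
      (fun x ↦ (⟨x, X x⟩ : TangentBundle (𝓡 m) M)) p.1) :
    MDifferentiableAt (cylModel m) (cylModel m).tangent
      (fun q ↦ (⟨q, vert q (X q.1)⟩ : TangentBundle (cylModel m) (Cylinder M a b))) p := by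
  have h1 : MDifferentiableAt (cylModel m) (𝓡 m).tangent
      (fun q : Cylinder M a b ↦ (⟨q.1, X q.1⟩ : TangentBundle (𝓡 m) M)) p :=
    MDifferentiableAt.comp p hX mdifferentiableAt_fst
  have h2 : ContMDiff (cylModel m) (𝓘(ℝ, ℝ)).tangent ∞
      (fun p : Cylinder M a b ↦ (⟨p.2, (0 : ℝ)⟩ : TangentBundle 𝓘(ℝ, ℝ) (openInterval a b))) :=
    (contMDiff_zeroSection ℝ (TangentSpace 𝓘(ℝ, ℝ) : openInterval a b → Type _)).comp contMDiff_snd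
  exact ((contMDiff_equivTangentBundleProd_symm (I := 𝓡 m) (I' := 𝓘(ℝ, ℝ)) (M := M)
    (M' := openInterval a b) (n := ∞)).mdifferentiableAt (by simp)).comp p
      (h1.prodMk (h2.mdifferentiableAt (by simp)))

/-- Compose with the inclusion of the slice, then with the tangent map of the projection to `M`,
which recovers a vector from its vertical lift. -/
theorem mdifferentiableAt_slice_of_vert {p : Cylinder M a b}
    {Y : Π q : Cylinder M a b, TangentSpace (𝓡 m) q.1}
    (hY : MDifferentiableAt (cylModel m) (cylModel m).tangent
      (fun q ↦ (⟨q, vert q (Y q)⟩ : TangentBundle (cylModel m) (Cylinder M a b))) p) :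
    MDifferentiableAt (𝓡 m) (𝓡 m).tangent
      (fun x ↦ (⟨x, Y (x, p.2)⟩ : TangentBundle (𝓡 m) M)) p.1 := by
  have h1 := MDifferentiableAt.comp p.1 (f := fun x : M ↦ ((x, p.2) : Cylinder M a b)) hY
    ((contMDiff_slice p.2).mdifferentiableAt (by simp))
  have h2 := (((contMDiff_fst (I := 𝓡 m) (J := 𝓘(ℝ, ℝ)) (M := M) (N := openInterval a b)
    (n := ∞)).contMDiff_tangentMap (m := ∞) le_rfl).mdifferentiableAt (by simp)).comp p.1 h1
  refine h2.congr_of_eventuallyEq (Filter.Eventually.of_forall fun x ↦ ?_)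
  simp only [Function.comp_apply, tangentMap_prodFst]
  rfl

variable {g : openInterval a b →
      ContMDiffRiemannianMetric (𝓡 m) ∞ (Euc m) (TangentSpace (𝓡 m) : M → Type _)}
  {h : ContMDiffRiemannianMetric (cylModel m) ∞ (Euc m × ℝ)
      (TangentSpace (cylModel m) : Cylinder M a b → Type _)}

theorem IsCylinderMetric.inner_vert_vert (hgh : IsCylinderMetric g h) (p : Cylinder M a b)
    (v w : TangentSpace (𝓡 m) p.1) :
    h.inner p (vert p v) (vert p w) = (g p.2).inner p.1 v w := by
  simpa using hgh p v w 0 0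

theorem IsCylinderMetric.inner_vert_nu (hgh : IsCylinderMetric g h) (p : Cylinder M a b)
    (v : TangentSpace (𝓡 m) p.1) : h.inner p (vert p v) (nu p) = 0 := by
  simpa [vert_zero] using hgh p v 0 0 1

theorem IsCylinderMetric.inner_nu_vert (hgh : IsCylinderMetric g h) (p : Cylinder M a b)
    (v : TangentSpace (𝓡 m) p.1) : h.inner p (nu p) (vert p v) = 0 := by
  rw [h.symm, hgh.inner_vert_nu]

theorem IsCylinderMetric.inner_nu_nu (hgh : IsCylinderMetric g h) (p : Cylinder M a b) :
    h.inner p (nu p) (nu p) = 1 := by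
  simpa [vert_zero] using hgh p 0 0 1 1

end CylinderFields

/-! ### The Gauss formula; existence and uniqueness of the Weingarten map. -/

section Weingarten

variable {m : ℕ} {a b : EReal} {M : Type*} [TopologicalSpace M] [ChartedSpace (Euc m) M]
  [IsManifold (𝓡 m) ∞ M]
  {g : openInterval a b →
      ContMDiffRiemannianMetric (𝓡 m) ∞ (Euc m) (TangentSpace (𝓡 m) : M → Type _)}
  {h : ContMDiffRiemannianMetric (cylModel m) ∞ (Euc m × ℝ)
      (TangentSpace (cylModel m) : Cylinder M a b → Type _)}
  {nablaM : openInterval a b → CovariantDerivative (𝓡 m) (Euc m)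
      (TangentSpace (𝓡 m) : M → Type _)}
  {nablaN : CovariantDerivative (cylModel m) (Euc m × ℝ)
      (TangentSpace (cylModel m) : Cylinder M a b → Type _)}

/-- On vertical fields which do not depend on `s`, the Levi-Civita connection of a slice is the
tangential part of that of the cylinder. -/
theorem inner_nablaN_vert_const (hgh : IsCylinderMetric g h)
    (hM : ∀ s, IsLeviCivita (g s) (nablaM s)) (hN : IsLeviCivita h nablaN) {p : Cylinder M a b}
    {X Y Z : Π x : M, TangentSpace (𝓡 m) x}
    (hX : MDifferentiableAt (𝓡 m) (𝓡 m).tangent (fun x ↦ (⟨x, X x⟩ : TangentBundle (𝓡 m) M)) p.1)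
    (hY : MDifferentiableAt (𝓡 m) (𝓡 m).tangent (fun x ↦ (⟨x, Y x⟩ : TangentBundle (𝓡 m) M)) p.1)
    (hZ : MDifferentiableAt (𝓡 m) (𝓡 m).tangent (fun x ↦ (⟨x, Z x⟩ : TangentBundle (𝓡 m) M)) p.1) :
    h.inner p (nablaN (fun q ↦ vert q (Y q.1)) p (vert p (X p.1))) (vert p (Z p.1)) =
      (g p.2).inner p.1 (nablaM p.2 Y p.1 (X p.1)) (Z p.1) := by
  -- The difference of the two connections, paired with a third field. Metric compatibility makes it
  -- skew in the last two arguments; vanishing torsion, with the equality of the Lie brackets, makes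
  -- it symmetric in the first two.
  let D (A B C : Π x : M, TangentSpace (𝓡 m) x) : ℝ :=
    h.inner p (nablaN (fun q ↦ vert q (B q.1)) p (vert p (A p.1))) (vert p (C p.1)) -
      (g p.2).inner p.1 (nablaM p.2 B p.1 (A p.1)) (C p.1)
  have skew : ∀ A B C : Π x : M, TangentSpace (𝓡 m) x,
      MDifferentiableAt (𝓡 m) (𝓡 m).tangent
        (fun x ↦ (⟨x, B x⟩ : TangentBundle (𝓡 m) M)) p.1 →
      MDifferentiableAt (𝓡 m) (𝓡 m).tangent
        (fun x ↦ (⟨x, C x⟩ : TangentBundle (𝓡 m) M)) p.1 → D A B C + D A C B = 0 := by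
    intro A B C hB hC
    have h1 := hN.metric p (vert p (A p.1)) _ _ (mdifferentiableAt_vert hB)
      (mdifferentiableAt_vert hC)
    have h2 := (hM p.2).metric p.1 (A p.1) _ _ hB hC
    have h3 := mvfderiv_comp_slice
      (mdifferentiableAt_inner h (mdifferentiableAt_vert hB) (mdifferentiableAt_vert hC)) (A p.1)
    have h4 : (fun x : M ↦ h.inner (x, p.2) (vert (x, p.2) (B x)) (vert (x, p.2) (C x))) =
        fun x ↦ (g p.2).inner x (B x) (C x) := funext fun x ↦ hgh.inner_vert_vert (x, p.2) _ _
    rw [h4, h1, h2] at h3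
    rw [h.symm p (vert p (B p.1)), (g p.2).symm p.1 (B p.1)] at h3
    simp only [D]
    linarith
  have symm : ∀ A B C : Π x : M, TangentSpace (𝓡 m) x,
      MDifferentiableAt (𝓡 m) (𝓡 m).tangent
        (fun x ↦ (⟨x, A x⟩ : TangentBundle (𝓡 m) M)) p.1 →
      MDifferentiableAt (𝓡 m) (𝓡 m).tangent
        (fun x ↦ (⟨x, B x⟩ : TangentBundle (𝓡 m) M)) p.1 → D A B C = D B A C := by
    intro A B C hA hB
    have h1 := nablaN.torsion_eq_zero_iff.1 hN.torsion_eq_zero (mdifferentiableAt_vert hA)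
      (mdifferentiableAt_vert hB)
    have h2 := (nablaM p.2).torsion_eq_zero_iff.1 (hM p.2).torsion_eq_zero hA hB
    rw [mlieBracket_vert hA hB, ← h2] at h1
    have h3 := congrArg (fun v ↦ h.inner p v (vert p (C p.1))) h1
    have h4 := hgh.inner_vert_vert p
      (nablaM p.2 B p.1 (A p.1) - nablaM p.2 A p.1 (B p.1)) (C p.1)
    have h5 : h.inner p (nablaN (fun q ↦ vert q (B q.1)) p (vert p (A p.1)) -
        nablaN (fun q ↦ vert q (A q.1)) p (vert p (B p.1))) (vert p (C p.1)) =
        (g p.2).inner p.1 (nablaM p.2 B p.1 (A p.1) - nablaM p.2 A p.1 (B p.1)) (C p.1) :=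
      h3.trans h4
    rw [map_sub, map_sub, sub_apply, sub_apply] at h5
    simp only [D]
    linarith
  -- Alternating the two symmetries three times restores the order `X, Y, Z` with sign `(-1)³`, so
  -- `D X Y Z = -D X Y Z`.
  have e1 := symm X Y Z hX hY
  have e2 := skew Y X Z hX hZ
  have e3 := symm Y Z X hY hZ
  have e4 := skew Z Y X hY hX
  have e5 := symm Z X Y hZ hX
  have e6 := skew X Z Y hZ hY
  have e7 : D X Y Z = 0 := by linarith
  exact sub_eq_zero.1 e7

/-- The tangential Gauss formula. -/
theorem inner_nablaN_vert (hgh : IsCylinderMetric g h)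
    (hM : ∀ s, IsLeviCivita (g s) (nablaM s)) (hN : IsLeviCivita h nablaN) {p : Cylinder M a b}
    {Y : Π q : Cylinder M a b, TangentSpace (𝓡 m) q.1}
    (hY : MDifferentiableAt (cylModel m) (cylModel m).tangent
      (fun q ↦ (⟨q, vert q (Y q)⟩ : TangentBundle (cylModel m) (Cylinder M a b))) p)
    (X Z : TangentSpace (𝓡 m) p.1) :
    h.inner p (nablaN (fun q ↦ vert q (Y q)) p (vert p X)) (vert p Z) =
      (g p.2).inner p.1 (nablaM p.2 (fun x ↦ Y (x, p.2)) p.1 X) Z := by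
  have hY' := mdifferentiableAt_slice_of_vert hY
  -- The vectors `X` and `Z` are extended to fields on `M`, and `Y` is frozen at the parameter
  -- `p.2`, to reach the case of fields independent of `s`.
  have hX' := FiberBundle.mdifferentiableAt_extend (𝓡 m) (Euc m) X
  have hZ' := FiberBundle.mdifferentiableAt_extend (𝓡 m) (Euc m) Z
  have h0 := inner_nablaN_vert_const hgh hM hN hX' hY' hZ'
  rw [FiberBundle.extend_apply_self, FiberBundle.extend_apply_self] at h0
  rw [← h0]
  -- The field and its frozen version agree on the slice, so their products with `Z` have the same
  -- derivative along `X`. The terms containing `∇Z` also agree, as they involve only the values at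
  -- `p`.
  have h1 := hN.metric p (vert p X) _ _ hY (mdifferentiableAt_vert hZ')
  have h2 := hN.metric p (vert p X) _ _ (mdifferentiableAt_vert hY') (mdifferentiableAt_vert hZ')
  rw [← mvfderiv_comp_slice (mdifferentiableAt_inner h hY (mdifferentiableAt_vert hZ'))] at h1
  rw [← mvfderiv_comp_slice (mdifferentiableAt_inner h (mdifferentiableAt_vert hY')
    (mdifferentiableAt_vert hZ'))] at h2
  rw [FiberBundle.extend_apply_self] at h1 h2
  exact add_right_cancel (h1.symm.trans h2)

theorem mdifferentiableAt_nu (p : Cylinder M a b) :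
    MDifferentiableAt (cylModel m) (cylModel m).tangent
      (fun q ↦ (⟨q, nu q⟩ : TangentBundle (cylModel m) (Cylinder M a b))) p :=
  VerticalSpinStructure.contMDiff_nu.mdifferentiableAt (by simp)

/-- Differentiate the identity `h(Y, ν) = 0`. -/
theorem inner_nablaN_vert_nu (hgh : IsCylinderMetric g h) (hN : IsLeviCivita h nablaN)
    {p : Cylinder M a b} {Y : Π q : Cylinder M a b, TangentSpace (𝓡 m) q.1}
    (hY : MDifferentiableAt (cylModel m) (cylModel m).tangent
      (fun q ↦ (⟨q, vert q (Y q)⟩ : TangentBundle (cylModel m) (Cylinder M a b))) p)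
    (V : TangentSpace (cylModel m) p) :
    h.inner p (nablaN (fun q ↦ vert q (Y q)) p V) (nu p) =
      -h.inner p (nablaN nu p V) (vert p (Y p)) := by
  have h1 := hN.metric p V _ _ hY (mdifferentiableAt_nu p)
  have h2 : (fun q ↦ h.inner q (vert q (Y q)) (nu q)) = fun _ ↦ (0 : ℝ) :=
    funext fun q ↦ hgh.inner_vert_nu q _
  rw [h2, mvfderiv_const, h.symm p (vert p (Y p))] at h1
  have h3 : (0 : ℝ) = _ := h1
  linarith

/-- Differentiate the identity `h(ν, ν) = 1`. -/
theorem inner_nablaN_nu_nu (hgh : IsCylinderMetric g h) (hN : IsLeviCivita h nablaN)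
    (p : Cylinder M a b) (V : TangentSpace (cylModel m) p) :
    h.inner p (nablaN nu p V) (nu p) = 0 := by
  have h1 := hN.metric p V _ _ (mdifferentiableAt_nu p) (mdifferentiableAt_nu p)
  have h2 : (fun q : Cylinder M a b ↦ h.inner q (nu q) (nu q)) = fun _ ↦ (1 : ℝ) :=
    funext fun q ↦ hgh.inner_nu_nu q
  rw [h2, mvfderiv_const, h.symm p (nu p)] at h1
  have h3 : (0 : ℝ) = _ := h1
  linarith

theorem eq_of_inner_vert_nu_eq {p : Cylinder M a b} {v w : TangentSpace (cylModel m) p}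
    (h1 : ∀ u, h.inner p v (vert p u) = h.inner p w (vert p u))
    (h2 : h.inner p v (nu p) = h.inner p w (nu p)) : v = w := by
  refine eq_of_forall_inner_eq h fun u ↦ ?_
  rw [← vert_vertProj_add p u, map_add, map_add, map_smul, map_smul, h1, h2]

/-- The Weingarten map `X ↦ -∇_X ν`. -/
def weingartenMap (nablaN : CovariantDerivative (cylModel m) (Euc m × ℝ)
      (TangentSpace (cylModel m) : Cylinder M a b → Type _)) (p : Cylinder M a b) :
    TangentSpace (𝓡 m) p.1 →L[ℝ] TangentSpace (𝓡 m) p.1 :=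
  -((vertProj p).comp ((nablaN nu p).comp
    (ContinuousLinearMap.inl ℝ (Euc m) ℝ :
      TangentSpace (𝓡 m) p.1 →L[ℝ] TangentSpace (cylModel m) p)))

/-- Since `∇_X ν` is orthogonal to `ν`, the projection in `weingartenMap` loses nothing. -/
theorem vert_weingartenMap (hgh : IsCylinderMetric g h) (hN : IsLeviCivita h nablaN)
    (p : Cylinder M a b) (X : TangentSpace (𝓡 m) p.1) :
    vert p (weingartenMap nablaN p X) = -nablaN nu p (vert p X) := by
  have h1 := vert_vertProj_add p (nablaN nu p (vert p X))
  have h2 := inner_nablaN_nu_nu hgh hN p (vert p X)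
  rw [← h1, map_add, add_apply, map_smul, hgh.inner_vert_nu, smul_apply, hgh.inner_nu_nu] at h2
  have h3 : nuCoord p (nablaN nu p (vert p X)) = 0 := by simpa using h2
  rw [h3, zero_smul, add_zero] at h1
  rw [← h1]
  refine Prod.ext rfl ?_
  exact neg_zero.symm

theorem isWeingartenMap_weingartenMap (hgh : IsCylinderMetric g h)
    (hM : ∀ s, IsLeviCivita (g s) (nablaM s)) (hN : IsLeviCivita h nablaN) :
    IsWeingartenMap g nablaM nablaN (weingartenMap nablaN) := by
  intro p X Y hY
  have hY' := hY.mdifferentiableAt (by simp)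
  -- The pairing with vertical vectors is the tangential Gauss formula; the pairing with `ν` is the
  -- derivative of `h(Y, ν) = 0`.
  refine eq_of_inner_vert_nu_eq (h := h) (fun u ↦ ?_) ?_
  · rw [map_smul, smul_apply, hgh.inner_nu_vert, smul_zero, map_sub, sub_apply,
      inner_nablaN_vert hgh hM hN hY', hgh.inner_vert_vert, sub_self]
  · rw [map_smul, smul_apply, hgh.inner_nu_nu, map_sub, sub_apply, hgh.inner_vert_nu, sub_zero,
      inner_nablaN_vert_nu hgh hN hY', ← hgh.inner_vert_vert p, vert_weingartenMap hgh hN,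
      map_neg, neg_apply]
    simp

theorem IsWeingartenMap.eq {W W' : Π p : Cylinder M a b,
      TangentSpace (𝓡 m) p.1 →L[ℝ] TangentSpace (𝓡 m) p.1}
    (hW : IsWeingartenMap g nablaM nablaN W) (hW' : IsWeingartenMap g nablaM nablaN W') :
    W = W' := by
  funext p
  ext1 X
  refine eq_of_forall_inner_eq (g p.2) fun u ↦ ?_
  -- An arbitrary tangent vector `u` is the value of a smooth vertical field, so the `ν`-component
  -- of the Weingarten equation determines the pairing of `W(X)` with every `u`.
  have hu := contMDiffAt_vert (p := p) (a := a) (b := b)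
    (FiberBundle.contMDiffAt_extend (k := ∞) (𝓡 m) (Euc m) u)
  have h1 := (hW p X (fun q ↦ FiberBundle.extend (Euc m) u q.1) hu).trans
    (hW' p X (fun q ↦ FiberBundle.extend (Euc m) u q.1) hu).symm
  have h2 := congrArg (fun v ↦ nuCoord p v) h1
  rw [FiberBundle.extend_apply_self, map_smul, map_smul] at h2
  have h3 : nuCoord p (nu p : TangentSpace (cylModel m) p) = 1 := rfl
  simpa [h3] using h2

end Weingarten

/-! ### Spinor module embeddings and the even Clifford algebra. -/

section CliffordAlgebraic

theorem clVec_smul {k : ℕ} (c : ℝ) (v : Euc k) : clVec (c • v) = c • clVec v :=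
  map_smul _ _ _

theorem clVec_eq_sum {k : ℕ} (v : Euc k) : clVec v = ∑ i, v i • clVec (stdVec i) := by
  have h : v = ∑ i, v i • stdVec i := by
    ext j
    simp [stdVec, Pi.single_apply]
  calc clVec v = clVec (∑ i, v i • stdVec i) := by rw [← h]
    _ = _ := by
      refine (map_sum (CliffordAlgebra.ι (cliffordForm k)) _ _).trans ?_
      exact Finset.sum_congr rfl fun i _ ↦ clVec_smul _ _

theorem eucIncl_stdVec {m : ℕ} (i : Fin m) : eucIncl m (stdVec i) = stdVec i.castSucc := by
  ext l
  refine Fin.lastCases ?_ (fun j ↦ ?_) l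
  · simp [eucIncl_last, stdVec]
  · simp [eucIncl_castSucc, stdVec]

theorem clVec_last_mul_clVec_eucIncl {m : ℕ} (v : Euc m) :
    clVec (stdVec (Fin.last m)) * clVec (eucIncl m v) =
      -(clVec (eucIncl m v) * clVec (stdVec (Fin.last m))) := by
  refine CliffordAlgebra.ι_mul_ι_comm_of_isOrtho ?_
  rw [QuadraticMap.isOrtho_def, cliffordForm_apply, cliffordForm_apply, cliffordForm_apply,
    norm_add_sq_real]
  have : inner ℝ (stdVec (Fin.last m)) (eucIncl m v) = 0 := by
    rw [stdVec, EuclideanSpace.inner_single_left, eucIncl_last]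
    simp
  rw [this]
  ring

theorem clVec_mul_clVec_mem_even {k : ℕ} (v w : Euc k) :
    clVec v * clVec w ∈ CliffordAlgebra.evenOdd (cliffordForm k) 0 :=
  CliffordAlgebra.ι_mul_ι_mem_evenOdd_zero _ v w

namespace CliffordModule

variable {k : ℕ} {S : Type*} [NormedAddCommGroup S] [InnerProductSpace ℂ S]

/-- The orbit map of a vector of a Clifford module, as a real-linear map. -/
def orbit (R : CliffordModule k S) (φ : S) : Cl k →ₗ[ℝ] S where
  toFun x := R.act x φ
  map_add' x y := by simp [act, TensorProduct.tmul_add]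
  map_smul' c x := by
    have : ((1 : ℂ) ⊗ₜ[ℝ] (c • x) : CCl k) = (c : ℂ) • ((1 : ℂ) ⊗ₜ[ℝ] x) := by
      rw [TensorProduct.tmul_smul, TensorProduct.smul_tmul', TensorProduct.smul_tmul']
      simp
    simp only [act, this, map_smul]
    simp

theorem orbit_apply (R : CliffordModule k S) (φ : S) (x : Cl k) : R.orbit φ x = R.act x φ := rfl

end CliffordModule

variable {m : ℕ} {S S' : Type*} [NormedAddCommGroup S] [InnerProductSpace ℂ S]
  [NormedAddCommGroup S'] [InnerProductSpace ℂ S']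
  {R : CliffordModule m S} {R' : CliffordModule (m + 1) S'}

/-- The vector `E_n` commutes with even elements of `Cl m`, so the correction term in `(ℐ ∓ i E_n ·
ℐ) / √2` preserves equivariance on the even part. On odd elements it would change sign. -/
theorem evenEmbedding_act {ℐ : S →L[ℂ] S'}
    (hℐ : ∀ (x : Cl m) φ, ℐ (R.act x φ) = R'.act (clIncl m x) (ℐ φ)) (s : ℂ) {x : Cl m}
    (hx : x ∈ CliffordAlgebra.evenOdd (cliffordForm m) 0) (φ : S) :
    evenEmbedding R' s ℐ (R.act x φ) = R'.act (clIncl m x) (evenEmbedding R' s ℐ φ) := by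
  have h := congrArg (fun y ↦ R'.act y (ℐ φ)) (commute_clIncl_last hx)
  simp only [CliffordModule.act_mul] at h
  have h' : R'.act (clIncl m x) (R'.act (clVec (stdVec (Fin.last m))) (ℐ φ)) =
    R'.act (clVec (stdVec (Fin.last m))) (R'.act (clIncl m x) (ℐ φ)) := h
  simp [evenEmbedding, hℐ, h']

/-- The algebraic embeddings commute with the even part of the Clifford algebra. -/
theorem IsSpinorModuleEmbedding.map_act {j : S →L[ℂ] S'} (hj : IsSpinorModuleEmbedding R R' j)
    {x : Cl m} (hx : x ∈ CliffordAlgebra.evenOdd (cliffordForm m) 0) (φ : S) :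
    j (R.act x φ) = R'.act (clIncl m x) (j φ) := by
  have incl : ∀ x : Cl m, R'.rep (cclIncl m ((1 : ℂ) ⊗ₜ[ℝ] x)) = R'.act (clIncl m x) := fun x ↦ by
    simp [cclIncl, CliffordModule.act]
  cases hj with
  | odd hn hR hR' J hJ => exact (hJ _ φ).trans (by rw [incl]; rfl)
  | oddSharp hn hR hR' J hJ => exact (hJ _ φ).trans (by rw [incl]; rfl)
  | even hn hR hR' T Q hQ ℐ hℐ s hs ℐ₁ hℐ₁ =>
    refine evenEmbedding_act (fun x φ ↦ ?_) s hx φ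
    -- With zero in the other summand, equivariance of the isomorphism on the direct sum becomes
    -- equivariance of its restriction.
    have h := hℐ ((1 : ℂ) ⊗ₜ[ℝ] x) φ 0
    rw [map_zero, incl] at h
    rw [hℐ₁, hℐ₁]
    exact h
  | evenSharp hn hR hR' T Q hQ ℐ hℐ s hs ℐ₂ hℐ₂ =>
    refine evenEmbedding_act (fun x φ ↦ ?_) s hx φ
    have h := hℐ ((1 : ℂ) ⊗ₜ[ℝ] x) 0 φ
    rw [map_zero, incl] at h
    rw [hℐ₂, hℐ₂]
    exact h

/-- The zeroth order term of the spinorial connection of a hypersurface frame. -/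
theorem sum_connection_act {j : S →L[ℂ] S'}
    (hj : ∀ {x : Cl m}, x ∈ CliffordAlgebra.evenOdd (cliffordForm m) 0 →
      ∀ φ, j (R.act x φ) = R'.act (clIncl m x) (j φ))
    {Γ : Fin m → Fin m → ℝ} {Γ' : Fin (m + 1) → Fin (m + 1) → ℝ} {w : Euc m}
    (h₁ : ∀ c d, Γ' c.castSucc d.castSucc = Γ c d) (h₂ : ∀ c, Γ' c.castSucc (Fin.last m) = w c)
    (h₃ : ∀ c, Γ' (Fin.last m) c.castSucc = -w c) (h₄ : Γ' (Fin.last m) (Fin.last m) = 0) (σ : S) :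
    ∑ a, ∑ b, Γ' a b • R'.act (clVec (stdVec a) * clVec (stdVec b)) (j σ) =
      j (∑ a, ∑ b, Γ a b • R.act (clVec (stdVec a) * clVec (stdVec b)) σ) +
        (2 : ℝ) • R'.act (clVec (eucIncl m w)) (R'.act (clVec (stdVec (Fin.last m))) (j σ)) := by
  have e₁ : ∀ c d : Fin m,
      R'.act (clVec (stdVec c.castSucc) * clVec (stdVec d.castSucc)) (j σ) =
        j (R.act (clVec (stdVec c) * clVec (stdVec d)) σ) := fun c d ↦ by
    rw [hj (clVec_mul_clVec_mem_even _ _), map_mul, clIncl_clVec, clIncl_clVec, eucIncl_stdVec,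
      eucIncl_stdVec]
  -- This sign cancels the one in `h₃`, so the last row and the last column of `Γ'` contribute
  -- equally; hence the factor 2.
  have e₂ : ∀ c : Fin m, R'.act (clVec (stdVec (Fin.last m)) * clVec (stdVec c.castSucc)) (j σ) =
      -R'.act (clVec (stdVec c.castSucc) * clVec (stdVec (Fin.last m))) (j σ) := fun c ↦ by
    rw [← eucIncl_stdVec, clVec_last_mul_clVec_eucIncl, ← R'.orbit_apply, map_neg, R'.orbit_apply]
  have e₃ : R'.act (clVec (eucIncl m w)) (R'.act (clVec (stdVec (Fin.last m))) (j σ)) =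
      ∑ c, w c • R'.act (clVec (stdVec c.castSucc) * clVec (stdVec (Fin.last m))) (j σ) := by
    have : R'.act (clVec (eucIncl m w)) (R'.act (clVec (stdVec (Fin.last m))) (j σ)) =
        R'.act (clVec (eucIncl m w) * clVec (stdVec (Fin.last m))) (j σ) := by
      rw [R'.act_mul]; rfl
    rw [this, clVec_eq_sum, Fin.sum_univ_castSucc, eucIncl_last, zero_smul, add_zero,
      Finset.sum_mul, ← R'.orbit_apply, map_sum]
    refine Finset.sum_congr rfl fun c _ ↦ ?_
    rw [eucIncl_castSucc, smul_mul_assoc, map_smul, R'.orbit_apply]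
  have e₄ : j (∑ a, ∑ b, Γ a b • R.act (clVec (stdVec a) * clVec (stdVec b)) σ) =
      ∑ a, ∑ b, Γ a b • j (R.act (clVec (stdVec a) * clVec (stdVec b)) σ) := by
    simp only [map_sum]
    refine Finset.sum_congr rfl fun a _ ↦ Finset.sum_congr rfl fun b _ ↦ ?_
    exact map_smul (j.restrictScalars ℝ) _ _
  rw [e₃, e₄]
  simp only [Fin.sum_univ_castSucc, h₁, h₂, h₃, h₄, e₁, e₂, Finset.sum_add_distrib, smul_neg,
    neg_smul, neg_neg, zero_smul, add_zero, two_smul, add_assoc]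

end CliffordAlgebraic

/-! ### Local representatives of spinor fields and adapted coordinates. -/

section Spinors

variable {m : ℕ} {a b : EReal} {M : Type*} [TopologicalSpace M] [ChartedSpace (Euc m) M]
  [IsManifold (𝓡 m) ∞ M]
  {g : openInterval a b →
      ContMDiffRiemannianMetric (𝓡 m) ∞ (Euc m) (TangentSpace (𝓡 m) : M → Type _)}
  {h : ContMDiffRiemannianMetric (cylModel m) ∞ (Euc m × ℝ)
      (TangentSpace (cylModel m) : Cylinder M a b → Type _)}
  {ι : Type*} {S S' : Type*}
  [NormedAddCommGroup S] [InnerProductSpace ℂ S] [FiniteDimensional ℂ S]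
  [NormedAddCommGroup S'] [InnerProductSpace ℂ S'] [FiniteDimensional ℂ S']
  {R : CliffordModule m S} {R' : CliffordModule (m + 1) S'}

namespace VerticalSpinStructure

/-- The function `σ` with `φ = [q_i, σ]`, for a section `φ` of `Σ_M N`. -/
def localRep (P : VerticalSpinStructure g ι) (R : CliffordModule m S) (φ : Π p, P.Spinor R p)
    (i : ι) (p : Cylinder M a b) : S :=
  (P.spinorBundle R).coordChange (P.indexAt p) i p (φ p)

theorem localRep_indexAt (P : VerticalSpinStructure g ι) (φ : Π p, P.Spinor R p)
    (p : Cylinder M a b) : P.localRep R φ (P.indexAt p) p = φ p :=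
  (P.spinorBundle R).coordChange_self _ p (P.mem_baseSet_at p) _

theorem mdifferentiableAt_localRep {P : VerticalSpinStructure g ι} {φ : Π p, P.Spinor R p}
    (hφ : P.IsSmoothSpinorField R φ) (p : Cylinder M a b) :
    MDifferentiableAt (cylModel m) 𝓘(ℝ, S) (P.localRep R φ (P.indexAt p)) p :=
  -- The preferred trivialization at `p` is the one given by the section with index `P.indexAt p`,
  -- so its fibre coordinate is `localRep`.
  ((contMDiffAt_totalSpace.1 (hφ p)).2).mdifferentiableAt (by simp)

/-- Transition functions take values in the spin group, which is contained in the even part, so `j`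
intertwines the coordinate changes of the two spinor bundles. -/
theorem localRep_embedSpinor (P : VerticalSpinStructure g ι) (hgh : IsCylinderMetric g h)
    {j : S →L[ℂ] S'} (hj : IsSpinorModuleEmbedding R R' j) (φ : Π p, P.Spinor R p) (i : ι) :
    (P.total hgh).localRep R' (fun q ↦ P.embedSpinor hgh R R' j q (φ q)) i =
      fun p ↦ j (P.localRep R φ i p) :=
  funext fun p ↦ (hj.map_act (P.transition i (P.indexAt p) p).2.2 (φ p)).symm

theorem coords_total_vert (P : VerticalSpinStructure g ι) (hgh : IsCylinderMetric g h)
    (p : Cylinder M a b) (X : TangentSpace (𝓡 m) p.1) :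
    (P.total hgh).coords p (vert p X) =
      eucIncl m (WithLp.toLp 2 fun c ↦ (g p.2).inner p.1 X (P.frame (P.indexAt p) p c)) := by
  ext l
  refine Fin.lastCases ?_ (fun c ↦ ?_) l
  · rw [eucIncl_last]
    simp [SpinStructure.coords, total, hgh.inner_vert_nu]
  · rw [eucIncl_castSucc]
    simp [SpinStructure.coords, total, hgh.inner_vert_vert]

theorem coords_total_nu (P : VerticalSpinStructure g ι) (hgh : IsCylinderMetric g h)
    (p : Cylinder M a b) : (P.total hgh).coords p (nu p) = stdVec (Fin.last m) := by
  ext l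
  refine Fin.lastCases ?_ (fun c ↦ ?_) l
  · simp [SpinStructure.coords, total, hgh.inner_nu_nu, stdVec]
  · simp [SpinStructure.coords, total, hgh.inner_nu_vert, stdVec, Fin.castSucc_ne_last]

end VerticalSpinStructure

end Spinors

/-! ### Comparison of the spinorial connections. -/

section SpinorDerivative

variable {m : ℕ} {a b : EReal} {M : Type*} [TopologicalSpace M] [ChartedSpace (Euc m) M]
  [IsManifold (𝓡 m) ∞ M]
  {g : openInterval a b →
      ContMDiffRiemannianMetric (𝓡 m) ∞ (Euc m) (TangentSpace (𝓡 m) : M → Type _)}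
  {h : ContMDiffRiemannianMetric (cylModel m) ∞ (Euc m × ℝ)
      (TangentSpace (cylModel m) : Cylinder M a b → Type _)}
  {nablaM : openInterval a b → CovariantDerivative (𝓡 m) (Euc m)
      (TangentSpace (𝓡 m) : M → Type _)}
  {nablaN : CovariantDerivative (cylModel m) (Euc m × ℝ)
      (TangentSpace (cylModel m) : Cylinder M a b → Type _)}
  {ι : Type*} {S S' : Type*}
  [NormedAddCommGroup S] [InnerProductSpace ℂ S] [FiniteDimensional ℂ S]
  [NormedAddCommGroup S'] [InnerProductSpace ℂ S'] [FiniteDimensional ℂ S']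
  {R : CliffordModule m S} {R' : CliffordModule (m + 1) S'}

theorem mvfderiv_clm_comp {E H B F F' : Type*} [NormedAddCommGroup E] [NormedSpace ℝ E]
    [TopologicalSpace H] {I : ModelWithCorners ℝ E H} [TopologicalSpace B] [ChartedSpace H B]
    [NormedAddCommGroup F] [NormedSpace ℝ F] [NormedAddCommGroup F'] [NormedSpace ℝ F']
    (L : F →L[ℝ] F') {f : B → F} {p : B} (hf : MDifferentiableAt I 𝓘(ℝ, F) f p)
    (X : TangentSpace I p) : mvfderiv I (fun q ↦ L (f q)) p X = L (mvfderiv I f p X) := by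
  have h1 := (L.hasFDerivAt (x := f p)).hasMFDerivAt.comp p hf.hasMFDerivAt
  have h2 : mfderiv I 𝓘(ℝ, F') (fun q ↦ L (f q)) p = _ := h1.mfderiv
  change mfderiv I 𝓘(ℝ, F') (fun q ↦ L (f q)) p X = _
  rw [h2]
  rfl

/-- In the section `q_i` with `i = P.indexAt p`, the derivative terms correspond under the constant
linear map `j`. Only the connection matrices differ, and the Weingarten equation for the frame
fields supplies the difference. -/
theorem spinorDeriv_embedSpinor (P : VerticalSpinStructure g ι) (hgh : IsCylinderMetric g h)
    (hN : IsLeviCivita h nablaN) {j : S →L[ℂ] S'} (hj : IsSpinorModuleEmbedding R R' j)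
    {W : Π p : Cylinder M a b, TangentSpace (𝓡 m) p.1 →L[ℝ] TangentSpace (𝓡 m) p.1}
    (hW : IsWeingartenMap g nablaM nablaN W) {φ : Π p, P.Spinor R p}
    (hφ : P.IsSmoothSpinorField R φ) (p : Cylinder M a b) (X : TangentSpace (𝓡 m) p.1) :
    (P.total hgh).spinorDeriv nablaN R' (fun q ↦ P.embedSpinor hgh R R' j q (φ q)) p (vert p X) =
      P.embedSpinor hgh R R' j p (P.sliceSpinorDeriv nablaM R φ p X) +
        (1 / 2 : ℝ) • (P.total hgh).cliffordMul R' p (vert p (W p X))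
          ((P.total hgh).cliffordMul R' p (nu p) (P.embedSpinor hgh R R' j p (φ p))) := by
  set i := P.indexAt p
  have hframe : ∀ c, ContMDiffAt (cylModel m) (cylModel m).tangent ∞
      (fun q ↦ (⟨q, vert q (P.frame i q c)⟩ : TangentBundle (cylModel m) (Cylinder M a b))) p :=
    fun c ↦ (P.frame_smooth i c).contMDiffAt
      ((P.isOpen_baseSet i).mem_nhds (P.mem_baseSet_at p))
  have gauss : ∀ c, nablaN (fun q ↦ vert q (P.frame i q c)) p (vert p X) =
      vert p (nablaM p.2 (fun x ↦ P.frame i (x, p.2) c) p.1 X) +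
        (g p.2).inner p.1 (W p X) (P.frame i p c) • nu p := fun c ↦ by
    rw [hW p X (fun q ↦ P.frame i q c) (hframe c)]
    abel
  let Γ : Fin m → Fin m → ℝ := fun c d ↦
    (g p.2).inner p.1 (nablaM p.2 (fun x ↦ P.frame i (x, p.2) c) p.1 X) (P.frame i p d)
  -- The connection matrix of the cylinder in the frame `(e_1, …, e_m, ν)`: the facts `h₁` to `h₄`
  -- identify it with `Γ` bordered by `w`, `-w` and the corner 0.
  let Γ' : Fin (m + 1) → Fin (m + 1) → ℝ := fun c d ↦
    h.inner p (nablaN (fun q ↦ (P.total hgh).frame i q c) p (vert p X))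
      ((P.total hgh).frame i p d)
  let w : Euc m := WithLp.toLp 2 fun c ↦ (g p.2).inner p.1 (W p X) (P.frame i p c)
  have fr : ∀ (q : Cylinder M a b) (c : Fin m),
      (P.total hgh).frame i q c.castSucc = vert q (P.frame i q c) := fun q c ↦ by
    simp [VerticalSpinStructure.total]
  have fr' : ∀ q : Cylinder M a b, (P.total hgh).frame i q (Fin.last m) = nu q := fun q ↦ by
    simp [VerticalSpinStructure.total]
  have h₁ : ∀ c d, Γ' c.castSucc d.castSucc = Γ c d := fun c d ↦ by
    simp only [Γ', Γ, fr]
    rw [gauss, map_add, add_apply, map_smul, smul_apply, hgh.inner_vert_vert, hgh.inner_nu_vert,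
      smul_zero, add_zero]
  have h₂ : ∀ c, Γ' c.castSucc (Fin.last m) = w c := fun c ↦ by
    simp only [Γ', w, fr, fr']
    rw [gauss, map_add, add_apply, map_smul, smul_apply, hgh.inner_vert_nu, hgh.inner_nu_nu]
    simp
  have h₃ : ∀ c, Γ' (Fin.last m) c.castSucc = -w c := fun c ↦ by
    rw [← h₂]
    simp only [Γ', fr, fr']
    rw [inner_nablaN_vert_nu hgh hN ((hframe c).mdifferentiableAt (by simp)), neg_neg]
  have h₄ : Γ' (Fin.last m) (Fin.last m) = 0 := by
    simp only [Γ', fr']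
    exact inner_nablaN_nu_nu hgh hN p _
  have hσ := P.mdifferentiableAt_localRep hφ p
  have hd : mvfderiv (cylModel m)
      ((P.total hgh).localRep R' (fun q ↦ P.embedSpinor hgh R R' j q (φ q)) i) p (vert p X) =
      j (mvfderiv (𝓡 m) (fun x : M ↦ P.localRep R φ i (x, p.2)) p.1 X) := by
    rw [P.localRep_embedSpinor hgh hj φ i, mvfderiv_comp_slice hσ]
    exact mvfderiv_clm_comp (j.restrictScalars ℝ) hσ _
  have hval : (P.total hgh).localRep R' (fun q ↦ P.embedSpinor hgh R R' j q (φ q)) i p =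
      j (P.localRep R φ i p) := by
    rw [P.localRep_embedSpinor hgh hj φ i]
  -- The spin structures on the slice and on the cylinder inherit their preferred index from `P`.
  -- Both derivatives are thus computed in the same section, and no independence of the chosen
  -- section is needed.
  have lhs : (P.total hgh).spinorDeriv nablaN R' (fun q ↦ P.embedSpinor hgh R R' j q (φ q)) p
      (vert p X) = (mvfderiv (cylModel m)
        ((P.total hgh).localRep R' (fun q ↦ P.embedSpinor hgh R R' j q (φ q)) i) p (vert p X) +
      (1 / 4 : ℝ) • ∑ c, ∑ d, Γ' c d • R'.act (clVec (stdVec c) * clVec (stdVec d))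
        ((P.total hgh).localRep R' (fun q ↦ P.embedSpinor hgh R R' j q (φ q)) i p) : S') := rfl
  have rhs : P.sliceSpinorDeriv nablaM R φ p X =
      (mvfderiv (𝓡 m) (fun x : M ↦ P.localRep R φ i (x, p.2)) p.1 X +
      (1 / 4 : ℝ) • ∑ c, ∑ d, Γ c d • R.act (clVec (stdVec c) * clVec (stdVec d))
        (P.localRep R φ i p) : S) := rfl
  have rhs' : (P.total hgh).cliffordMul R' p (vert p (W p X))
      ((P.total hgh).cliffordMul R' p (nu p) (P.embedSpinor hgh R R' j p (φ p))) =
      R'.act (clVec (eucIncl m w))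
        (R'.act (clVec (stdVec (Fin.last m))) (j (P.localRep R φ i p))) := by
    have e : P.embedSpinor hgh R R' j p (φ p) = j (P.localRep R φ i p) :=
      congrArg j (P.localRep_indexAt φ p).symm
    rw [e]
    change R'.act (clVec ((P.total hgh).coords p (vert p (W p X))))
      (R'.act (clVec ((P.total hgh).coords p (nu p))) (j (P.localRep R φ i p))) = _
    rw [P.coords_total_vert hgh, P.coords_total_nu hgh]
  rw [lhs, rhs, rhs', hd, hval, sum_connection_act hj.map_act h₁ h₂ h₃ h₄]
  -- The factor 2 from the two borders turns the `¼` of the spinorial connection into `½`.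
  have fin : ∀ (x y : S) (z : S'),
      (j x + (1 / 4 : ℝ) • (j y + (2 : ℝ) • z) : S') = j (x + (1 / 4 : ℝ) • y) + (1 / 2 : ℝ) • z := by
    intro x y z
    have e : j ((1 / 4 : ℝ) • y) = (1 / 4 : ℝ) • j y := map_smul (j.restrictScalars ℝ) _ _
    rw [map_add, e, smul_add, smul_smul, add_assoc]
    norm_num
  exact fin _ _ _

end SpinorDerivative

end

theorem lemma2p2 {m : ℕ} {a b : EReal}
    {M : Type*} [TopologicalSpace M] [ChartedSpace (Euc m) M] [IsManifold (𝓡 m) ∞ M]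
    (g : openInterval a b →
      ContMDiffRiemannianMetric (𝓡 m) ∞ (Euc m) (TangentSpace (𝓡 m) : M → Type _))
    (h : ContMDiffRiemannianMetric (cylModel m) ∞ (Euc m × ℝ)
      (TangentSpace (cylModel m) : Cylinder M a b → Type _))
    (hgh : IsCylinderMetric g h)
    (nablaM : openInterval a b → CovariantDerivative (𝓡 m) (Euc m)
      (TangentSpace (𝓡 m) : M → Type _))
    (hM : ∀ s, IsLeviCivita (g s) (nablaM s))
    (nablaN : CovariantDerivative (cylModel m) (Euc m × ℝ)
      (TangentSpace (cylModel m) : Cylinder M a b → Type _))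
    (hN : IsLeviCivita h nablaN)
    {ι : Type*} (P : VerticalSpinStructure g ι)
    {S S' : Type*} [NormedAddCommGroup S] [InnerProductSpace ℂ S] [FiniteDimensional ℂ S]
    [NormedAddCommGroup S'] [InnerProductSpace ℂ S'] [FiniteDimensional ℂ S']
    (R : CliffordModule m S) (R' : CliffordModule (m + 1) S')
    (j : S →L[ℂ] S') (hj : IsSpinorModuleEmbedding R R' j) :
    (∃! W, IsWeingartenMap g nablaM nablaN W) ∧
    ∀ W, IsWeingartenMap g nablaM nablaN W →
      ∀ φ : Π p, P.Spinor R p, P.IsSmoothSpinorField R φ →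
        ∀ (p : Cylinder M a b) (X : TangentSpace (𝓡 m) p.1),
          (P.total hgh).spinorDeriv nablaN R' (fun q ↦ P.embedSpinor hgh R R' j q (φ q)) p
              (vert p X) =
            P.embedSpinor hgh R R' j p (P.sliceSpinorDeriv nablaM R φ p X) +
              (1 / 2 : ℝ) • (P.total hgh).cliffordMul R' p (vert p (W p X))
                ((P.total hgh).cliffordMul R' p (nu p)
                  (P.embedSpinor hgh R R' j p (φ p))) := by
  refine ⟨⟨weingartenMap nablaN, isWeingartenMap_weingartenMap hgh hM hN, fun W hW ↦
    hW.eq (isWeingartenMap_weingartenMap hgh hM hN)⟩, fun W hW φ hφ p X ↦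
    spinorDeriv_embedSpinor P hgh hN hj hW hφ p X⟩
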